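/- For a bounded complex sequence $x=(x_n)_{n\ge 1}$ put $\hat x:=(\sup_{k\ge n}|x_k|)_{n}$. For $1<q<\infty$ let $d(q):=\{x\in\ell_\infty:\hat x\in\ell_q\}$, a Banach space with the norm $\|x\|_{d(q)}:=\|\hat x\|_{q}$. For $1\le p<\infty$ let $d(p+):=\bigcap_{q>p}d(q)$, equipped with the locally convex topology given by the norms $\|\cdot\|_{d(q)}$, $q>p$. For $1<p\le\infty$ let $d(p-):=\bigcup_{1<q<p}d(q)$, equipped with the locally convex inductive limit topology, i.e. the finest locally convex topology for which all inclusions $d(q)\subseteq d(p-)$, $1<q<p$, are continuous. Let $\alpha:=(\log n)_{n\ge1}$. For $s\in\{1,\infty\}$ let $$\Lambda^s_0(\alpha):=\{x\in\mathbb C^{\mathbb N}:(x_n n^{t})_n\in\ell_s\ \text{for all } t<0\}$$ be the power series space of finite type $0$ and order $s$, equipped with the topology given by the norms $x\mapsto\|(x_n n^{t})_n\|_{s}$, $t<0$. A (DFS)-space is a locally convex space isomorphic to the strong dual of a Fréchet–Schwartz space; isomorphic means linearly homeomorphic. Then: (i) For each $1<p\le\infty$, the space $d(p-)$ is a non-nuclear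 (DFS)-space which is isomorphic to the strong dual $(\Lambda^1_0(\alpha))'_\beta$ of $\Lambda^1_0(\alpha)$. (ii) For each $1\le p<\infty$, the space $d(p+)$ is a non-nuclear Fréchet–Schwartz space which is isomorphic to $\Lambda^\infty_0(\alpha)$. -/

import Mathlib

open scoped ENNReal Topology
open UniformSpace

noncomputable section

namespace CesaroDual

/-! ### Locally convex spaces over `ℂ`

`PolynormableSpace ℂ E` says that `E` is a locally convex space: its topology is given by a
family of seminorms. -/

section LocallyConvex

variable (E : Type*) [AddCommGroup E] [Module ℂ E]

/-- A (complex) Fréchet space: a locally convex Hausdorff space that is metrizable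
(first countable) and complete for its canonical uniformity. -/
structure IsFrechetSpace [TopologicalSpace E] [IsTopologicalAddGroup E] : Prop where
  locallyConvex : PolynormableSpace ℂ E
  hausdorff : T2Space E
  firstCountable : FirstCountableTopology E
  complete : @CompleteSpace E (IsTopologicalAddGroup.rightUniformSpace E)

/-- A Schwartz space: for each neighbourhood `U` of zero there is a neighbourhood `V` of zero such
that for each `ε > 0` finitely many translates of `ε U` cover `V`. -/
def IsSchwartzSpace [TopologicalSpace E] : Prop :=
  ∀ U ∈ 𝓝 (0 : E), ∃ V ∈ 𝓝 (0 : E), ∀ ε : ℝ, 0 < ε →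
    ∃ S : Finset E, ∀ v ∈ V, ∃ x ∈ S, ∃ u ∈ U, v = x + (ε : ℂ) • u

/-- A Fréchet–Schwartz space. -/
structure IsFrechetSchwartzSpace [TopologicalSpace E] [IsTopologicalAddGroup E] : Prop where
  frechet : IsFrechetSpace E
  schwartz : IsSchwartzSpace E

/-- A (DFS)-space: a space isomorphic to the strong dual of a Fréchet–Schwartz space.
(`StrongDual ℂ F` carries the topology of uniform convergence on bounded sets.) -/
def IsDFSSpace (E : Type) [AddCommGroup E] [Module ℂ E] [TopologicalSpace E] : Prop :=
  ∃ (F : Type) (_ : AddCommGroup F) (_ : Module ℂ F) (_ : TopologicalSpace F)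
    (_ : IsTopologicalAddGroup F),
    IsFrechetSchwartzSpace F ∧ Nonempty (E ≃L[ℂ] StrongDual ℂ F)

variable {E}

/-- The space `E` equipped with the single seminorm `p`. -/
def WithSeminorm (_p : Seminorm ℂ E) : Type _ := E

instance (p : Seminorm ℂ E) : SeminormedAddCommGroup (WithSeminorm p) :=
  p.toSeminormedAddCommGroup

instance (p : Seminorm ℂ E) : NormedSpace ℂ (WithSeminorm p) where
  toModule := inferInstanceAs (Module ℂ E)
  norm_smul_le a x := (map_smul_eq_mul p a x).le

/-- The local Banach space of the seminorm `p`: the (Hausdorff) completion of `(E, p)`, that is,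
the completion of the normed space `E / ker p`. -/
abbrev LocalBanachSpace (p : Seminorm ℂ E) : Type _ := Completion (WithSeminorm p)

/-- The identity map `(E, q) → (E, p)`, for `p ≤ q`. -/
def changeSeminorm {p q : Seminorm ℂ E} (h : p ≤ q) : WithSeminorm q →L[ℂ] WithSeminorm p :=
  LinearMap.mkContinuous (LinearMap.id (R := ℂ) (M := E) : WithSeminorm q →ₗ[ℂ] WithSeminorm p) 1
    fun x => by rw [one_mul]; exact h x

/-- The canonical map between the local Banach spaces of the seminorms `p ≤ q`. -/
def linkingMap {p q : Seminorm ℂ E} (h : p ≤ q) :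
    LocalBanachSpace q →L[ℂ] LocalBanachSpace p :=
  (changeSeminorm h).completion

/-- A nuclear operator: `T x = ∑ aₙ(x) yₙ` with `∑ ‖aₙ‖ ‖yₙ‖ < ∞`. -/
def IsNuclearMap {X Y : Type*} [NormedAddCommGroup X] [NormedSpace ℂ X]
    [NormedAddCommGroup Y] [NormedSpace ℂ Y] (T : X →L[ℂ] Y) : Prop :=
  ∃ (a : ℕ → StrongDual ℂ X) (y : ℕ → Y),
    Summable (fun n => ‖a n‖ * ‖y n‖) ∧ ∀ x, HasSum (fun n => a n x • y n) (T x)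

variable (E)

/-- A nuclear locally convex space: for each continuous seminorm `p` there is a continuous seminorm
`q ≥ p` such that the canonical map between the local Banach spaces is nuclear. -/
def IsNuclearSpace [TopologicalSpace E] : Prop :=
  ∀ p : Seminorm ℂ E, Continuous p → ∃ q : Seminorm ℂ E, Continuous q ∧
    ∃ h : p ≤ q, IsNuclearMap (linkingMap h)

variable {E}

/-- The locally convex inductive topology: the finest locally convex topology on `E` for which all
the maps `f i` are continuous. (In Mathlib finer topologies are smaller.) -/
@[reducible] def inductiveTopology {ι : Type*} {G : ι → Type*} [∀ i, TopologicalSpace (G i)]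
    (f : ∀ i, G i → E) : TopologicalSpace E :=
  sInf {t : TopologicalSpace E | @PolynormableSpace ℂ E _ _ _ t ∧
    ∀ i, @Continuous (G i) E _ t (f i)}

end LocallyConvex

/-! ### The Banach spaces `d(q)`

Sequences are functions on `ℕ+ = {1, 2, 3, …}`. -/

/-- The least decreasing majorant `x̂ₙ = sup_{k ≥ n} |x_k|` of a bounded sequence `x`. -/
def hat (x : ℕ+ → ℂ) (n : ℕ+) : ℝ := ⨆ k : Set.Ici n, ‖x k‖

theorem bddAbove_tail {x : ℕ+ → ℂ} (hx : Memℓp x ∞) (n : ℕ+) :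
    BddAbove (Set.range fun k : Set.Ici n => ‖x k‖) := by
  obtain ⟨C, hC⟩ := hx.bddAbove
  exact ⟨C, by rintro _ ⟨k, rfl⟩; exact hC ⟨k, rfl⟩⟩

theorem hat_nonneg (x : ℕ+ → ℂ) (n : ℕ+) : 0 ≤ hat x n :=
  Real.iSup_nonneg fun _ => norm_nonneg _

theorem norm_le_hat {x : ℕ+ → ℂ} (hx : Memℓp x ∞) {n k : ℕ+} (h : n ≤ k) : ‖x k‖ ≤ hat x n :=
  le_ciSup (bddAbove_tail hx n) (⟨k, h⟩ : Set.Ici n)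

theorem hat_zero : hat 0 = 0 := by
  funext n
  simp [hat]

theorem hat_add_le {x y : ℕ+ → ℂ} (hx : Memℓp x ∞) (hy : Memℓp y ∞) (n : ℕ+) :
    hat (x + y) n ≤ hat x n + hat y n :=
  Real.iSup_le (fun k => (norm_add_le _ _).trans
    (add_le_add (norm_le_hat hx k.2) (norm_le_hat hy k.2)))
    (add_nonneg (hat_nonneg _ _) (hat_nonneg _ _))

theorem hat_smul (c : ℂ) (x : ℕ+ → ℂ) : hat (c • x) = ‖c‖ • hat x := by
  funext n
  change (⨆ k : Set.Ici n, ‖c * x k‖) = ‖c‖ * ⨆ k : Set.Ici n, ‖x k‖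
  rw [Real.mul_iSup_of_nonneg (norm_nonneg c)]
  simp only [norm_mul]

/-- The underlying vector space of `d(q)`: the bounded sequences `x` with `x̂ ∈ ℓ_q`. -/
def dSubmodule (q : ℝ≥0∞) : Submodule ℂ (ℕ+ → ℂ) where
  carrier := {x | Memℓp x ∞ ∧ Memℓp (hat x) q}
  zero_mem' := ⟨zero_memℓp, by rw [hat_zero]; exact zero_memℓp⟩
  add_mem' := fun {x y} hx hy => ⟨hx.1.add hy.1, (hx.2.add hy.2).mono fun n => by
    rw [Real.norm_of_nonneg (hat_nonneg _ _), Pi.add_apply]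
    exact hat_add_le hx.1 hy.1 n⟩
  smul_mem' := fun c x hx => ⟨hx.1.const_smul c, by rw [hat_smul]; exact hx.2.const_smul ‖c‖⟩

theorem dSubmodule_mono : Monotone dSubmodule := fun _ _ h _ hx =>
  ⟨hx.1, hx.2.of_exponent_ge h⟩

/-- The space `d(q)`, for `1 ≤ q ≤ ∞` (it is used for `1 < q < ∞` only). -/
def DSpace (q : ℝ≥0∞) : Type := dSubmodule q

namespace DSpace

variable {q : ℝ≥0∞}

instance : AddCommGroup (DSpace q) := inferInstanceAs (AddCommGroup (dSubmodule q))

instance : Module ℂ (DSpace q) := inferInstanceAs (Module ℂ (dSubmodule q))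

/-- The sequence `x̂` as an element of `ℓ_q`. -/
def hatLp (x : DSpace q) : lp (fun _ : ℕ+ => ℝ) q := ⟨hat x.1, x.2.2⟩

/-- The norm `‖x‖_{d(q)} = ‖x̂‖_q`. -/
instance : Norm (DSpace q) := ⟨fun x => ‖hatLp x‖⟩

theorem norm_def (x : DSpace q) : ‖x‖ = ‖hatLp x‖ := rfl

variable [hq : Fact (1 ≤ q)]

theorem q_ne_zero (q : ℝ≥0∞) [hq : Fact (1 ≤ q)] : q ≠ 0 := (zero_lt_one.trans_le hq.out).ne'

theorem core : NormedSpace.Core ℂ (DSpace q) where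
  norm_nonneg x := norm_nonneg (hatLp x)
  norm_smul c x := by
    have : hatLp (c • x) = ‖c‖ • hatLp x := Subtype.ext (hat_smul c x.1)
    rw [norm_def, norm_def, this, norm_smul, norm_norm]
  norm_triangle x y := by
    refine le_trans (lp.norm_mono (q_ne_zero q) (y := hatLp x + hatLp y) fun n => ?_)
      (norm_add_le (hatLp x) (hatLp y))
    have h1 : 0 ≤ hat (x + y).1 n := hat_nonneg _ _
    have h2 : 0 ≤ hat x.1 n + hat y.1 n := add_nonneg (hat_nonneg _ _) (hat_nonneg _ _)
    change ‖hat (x + y).1 n‖ ≤ ‖hat x.1 n + hat y.1 n‖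
    rw [Real.norm_of_nonneg h1, Real.norm_of_nonneg h2]
    exact hat_add_le x.2.1 y.2.1 n
  norm_eq_zero_iff x := by
    constructor
    · intro h
      have h0 : hatLp x = 0 := norm_eq_zero.1 h
      have h1 : ∀ n, hat x.1 n = 0 := fun n => congrFun (congrArg Subtype.val h0) n
      refine Subtype.ext (funext fun n => norm_le_zero_iff.1 ?_)
      exact (norm_le_hat x.2.1 le_rfl).trans (h1 n).le
    · rintro rfl
      have : hatLp (0 : DSpace q) = 0 := Subtype.ext hat_zero
      rw [norm_def, this, norm_zero]

instance : NormedAddCommGroup (DSpace q) := .ofCore core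

instance : NormedSpace ℂ (DSpace q) := .ofCore core

end DSpace

/-! ### The Fréchet spaces `d(p+)` -/

/-- The exponents `q` with `1 < q < ∞` and `q > p`. (For `p ≥ 1` the first bound is automatic.) -/
abbrev PlusIndex (p : ℝ≥0∞) : Type := {q : ℝ≥0∞ // 1 < q ∧ p < q ∧ q < ∞}

instance {p : ℝ≥0∞} (q : PlusIndex p) : Fact (1 ≤ q.1) := ⟨q.2.1.le⟩

/-- The vector space `d(p+) = ⋂_{q > p} d(q)`. -/
def dPlusSubmodule (p : ℝ≥0∞) : Submodule ℂ (ℕ+ → ℂ) := ⨅ q : PlusIndex p, dSubmodule q.1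

/-- The space `d(p+)`. -/
def DPlus (p : ℝ≥0∞) : Type := dPlusSubmodule p

namespace DPlus

variable {p : ℝ≥0∞}

instance : AddCommGroup (DPlus p) := inferInstanceAs (AddCommGroup (dPlusSubmodule p))

instance : Module ℂ (DPlus p) := inferInstanceAs (Module ℂ (dPlusSubmodule p))

/-- The inclusion of `d(p+)` into `d(q)`, for `q > p`. -/
def incl (q : PlusIndex p) : DPlus p →ₗ[ℂ] DSpace q.1 :=
  Submodule.inclusion (iInf_le (fun q : PlusIndex p => dSubmodule q.1) q)

/-- The topology of `d(p+)` is the one given by the norms `‖·‖_{d(q)}`, `q > p`. -/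
instance : TopologicalSpace (DPlus p) := ⨅ q : PlusIndex p, .induced (incl q) inferInstance

instance : PolynormableSpace ℂ (DPlus p) :=
  .iInf fun q =>
    have := (norm_withSeminorms ℂ (DSpace q.1)).toPolynormableSpace
    .induced (incl q)

instance : IsTopologicalAddGroup (DPlus p) :=
  (PolynormableSpace.withSeminorms ℂ (DPlus p)).topologicalAddGroup

instance : ContinuousSMul ℂ (DPlus p) :=
  (PolynormableSpace.withSeminorms ℂ (DPlus p)).continuousSMul

end DPlus

/-! ### The (LB)-spaces `d(p-)` -/

/-- The exponents `q` with `1 < q < p`. -/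
abbrev MinusIndex (p : ℝ≥0∞) : Type := {q : ℝ≥0∞ // 1 < q ∧ q < p}

instance {p : ℝ≥0∞} (q : MinusIndex p) : Fact (1 ≤ q.1) := ⟨q.2.1.le⟩

/-- The vector space `d(p-) = ⋃_{1 < q < p} d(q)`; as the `d(q)` increase with `q`, the sum of
these subspaces is their union, see `mem_dMinusSubmodule`. -/
def dMinusSubmodule (p : ℝ≥0∞) : Submodule ℂ (ℕ+ → ℂ) := ⨆ q : MinusIndex p, dSubmodule q.1

theorem mem_dMinusSubmodule {p : ℝ≥0∞} (hp : 1 < p) {x : ℕ+ → ℂ} :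
    x ∈ dMinusSubmodule p ↔ ∃ q : ℝ≥0∞, 1 < q ∧ q < p ∧ x ∈ dSubmodule q := by
  obtain ⟨r, hr⟩ := exists_between hp
  have : Nonempty (MinusIndex p) := ⟨⟨r, hr⟩⟩
  have hdir : Directed (· ≤ ·) fun q : MinusIndex p => dSubmodule q.1 :=
    Monotone.directed_le fun _ _ h => dSubmodule_mono h
  rw [dMinusSubmodule, Submodule.mem_iSup_of_directed _ hdir]
  simp only [Subtype.exists, exists_prop, and_assoc]

/-- The space `d(p-)`. -/
def DMinus (p : ℝ≥0∞) : Type := dMinusSubmodule p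

namespace DMinus

variable {p : ℝ≥0∞}

instance : AddCommGroup (DMinus p) := inferInstanceAs (AddCommGroup (dMinusSubmodule p))

instance : Module ℂ (DMinus p) := inferInstanceAs (Module ℂ (dMinusSubmodule p))

/-- The inclusion of `d(q)` into `d(p-)`, for `1 < q < p`. -/
def incl (q : MinusIndex p) : DSpace q.1 →ₗ[ℂ] DMinus p :=
  Submodule.inclusion (le_iSup (fun q : MinusIndex p => dSubmodule q.1) q)

/-- `d(p-)` carries the locally convex inductive limit topology of the Banach spaces `d(q)`. -/
instance : TopologicalSpace (DMinus p) := inductiveTopology fun q : MinusIndex p => incl q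

instance : PolynormableSpace ℂ (DMinus p) := .sInf fun _ ht => ht.1

instance : IsTopologicalAddGroup (DMinus p) :=
  (PolynormableSpace.withSeminorms ℂ (DMinus p)).topologicalAddGroup

instance : ContinuousSMul ℂ (DMinus p) :=
  (PolynormableSpace.withSeminorms ℂ (DMinus p)).continuousSMul

end DMinus

/-! ### Power series spaces of finite type -/

/-- The vector space of the power series space `Λ^s_r(α)` of order `s ∈ [1, ∞]` and finite type `r`:
the sequences `x` with `(xₙ e^{t αₙ})ₙ ∈ ℓ_s` for every real `t < r`. -/
def powerSeriesSubmodule (s : ℝ≥0∞) (r : ℝ) (α : ℕ+ → ℝ) : Submodule ℂ (ℕ+ → ℂ) where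
  carrier := {x | ∀ t < r, Memℓp (fun n => (Real.exp (t * α n) : ℂ) * x n) s}
  zero_mem' := fun t _ => by
    simp only [Pi.zero_apply, mul_zero]
    exact zero_mem_ℓp'
  add_mem' := fun {x y} hx hy t ht => by
    simp only [Pi.add_apply, mul_add]
    exact (hx t ht).add (hy t ht)
  smul_mem' := fun c x hx t ht => by
    have := (hx t ht).const_smul c
    refine (congrArg (fun f : ℕ+ → ℂ => Memℓp f s) (funext fun n => ?_)).mp this
    simp only [Pi.smul_apply, smul_eq_mul]
    ring

/-- The power series space `Λ^s_r(α)` of order `s` and finite type `r`. -/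
def PowerSeriesSpace (s : ℝ≥0∞) (r : ℝ) (α : ℕ+ → ℝ) : Type := powerSeriesSubmodule s r α

namespace PowerSeriesSpace

variable {s : ℝ≥0∞} {r : ℝ} {α : ℕ+ → ℝ}

instance : AddCommGroup (PowerSeriesSpace s r α) :=
  inferInstanceAs (AddCommGroup (powerSeriesSubmodule s r α))

instance : Module ℂ (PowerSeriesSpace s r α) :=
  inferInstanceAs (Module ℂ (powerSeriesSubmodule s r α))

/-- The map `x ↦ (xₙ e^{t αₙ})ₙ` of `Λ^s_r(α)` into `ℓ_s`, for `t < r`. -/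
def weightMap (t : Set.Iio r) : PowerSeriesSpace s r α →ₗ[ℂ] lp (fun _ : ℕ+ => ℂ) s where
  toFun x := ⟨fun n => (Real.exp (t.1 * α n) : ℂ) * x.1 n, x.2 t.1 t.2⟩
  map_add' x y := Subtype.ext (funext fun n => mul_add _ (x.1 n) (y.1 n))
  map_smul' c x := Subtype.ext (funext fun n => mul_left_comm _ c (x.1 n))

variable [Fact (1 ≤ s)]

/-- The topology of `Λ^s_r(α)` is the one given by the norms `x ↦ ‖(xₙ e^{t αₙ})ₙ‖_s`, `t < r`. -/
instance : TopologicalSpace (PowerSeriesSpace s r α) :=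
  ⨅ t : Set.Iio r, .induced (weightMap t) inferInstance

instance : PolynormableSpace ℂ (PowerSeriesSpace s r α) :=
  .iInf fun t =>
    have := (norm_withSeminorms ℂ (lp (fun _ : ℕ+ => ℂ) s)).toPolynormableSpace
    .induced (weightMap t)

instance : IsTopologicalAddGroup (PowerSeriesSpace s r α) :=
  (PolynormableSpace.withSeminorms ℂ (PowerSeriesSpace s r α)).topologicalAddGroup

instance : ContinuousSMul ℂ (PowerSeriesSpace s r α) :=
  (PolynormableSpace.withSeminorms ℂ (PowerSeriesSpace s r α)).continuousSMul

end PowerSeriesSpace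

/-- The exponent sequence `α = (log n)ₙ`. -/
def logSeq (n : ℕ+) : ℝ := Real.log (n : ℝ)

end CesaroDual

end

open CesaroDual

/-! Since `x̂` is decreasing, `n * x̂ₙ^q ≤ ‖x‖_{d(q)}^q`, so `n^{1/q} |xₙ| ≤ ‖x‖_{d(q)}`
(`DSpace.powWeight_mul_norm_le`). Conversely, if `|xₙ| ≤ c n^{-s}` with `s > 1/q`, then `x̂` obeys
the same bound and lies in `ℓ_q` (`DSpace.exists_norm_le`). So `d(q)` is squeezed between sup-norm
spaces with power weights, and the gap between the exponents disappears in the intersection or union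
over `q`. The diagonal map `x ↦ (n^{1/p} xₙ)` then identifies `d(p+)` with `Λ^∞_0(log n)`.

For `d(p-)` the isomorphism is `φ ↦ (n^{-1/p} φ(eₙ))` on the dual of `Λ¹_0(log n)`. Its inverse is
continuous because it is so on each `d(q)`. The map itself is continuous because every continuous
seminorm of `d(p-)` is controlled by a weighted sup norm with weight `aₙ n^{1/p}`, where `a` grows
more slowly than every positive power (`DMinus.exists_weight`): then `{aₙ eₙ}` is bounded in
`Λ¹_0(log n)`, and the strong topology controls `φ` there.

The power series spaces are Fréchet–Schwartz because lowering the exponent of the weight is a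
diagonal operator with null diagonal, hence compact. Nuclearity fails by a trace argument
(`exists_sum_norm_le_of_isNuclearMap`): the vectors `n⁻¹ eₙ` are unconditionally bounded for every
continuous seminorm and some continuous seminorm dominates all coordinates, so nuclearity would make
the harmonic series converge. -/

noncomputable section

namespace CesaroDual

/-! ### Power weights -/

/-- The weight `n ↦ nˢ` on the positive integers. -/
def powWeight (s : ℝ) (n : ℕ+) : ℝ := (n : ℝ) ^ s

theorem one_le_coe (n : ℕ+) : (1 : ℝ) ≤ (n : ℝ) := by exact_mod_cast (one_le : 1 ≤ n)

theorem powWeight_pos (s : ℝ) (n : ℕ+) : 0 < powWeight s n :=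
  Real.rpow_pos_of_pos (zero_lt_one.trans_le (one_le_coe n)) s

theorem powWeight_add (s t : ℝ) (n : ℕ+) : powWeight (s + t) n = powWeight s n * powWeight t n :=
  Real.rpow_add (zero_lt_one.trans_le (one_le_coe n)) s t

theorem powWeight_zero (n : ℕ+) : powWeight 0 n = 1 := Real.rpow_zero _

theorem powWeight_neg_mul (s : ℝ) (n : ℕ+) : powWeight (-s) n * powWeight s n = 1 := by
  rw [← powWeight_add, neg_add_cancel, powWeight_zero]

theorem powWeight_mono {s t : ℝ} (h : s ≤ t) (n : ℕ+) : powWeight s n ≤ powWeight t n :=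
  Real.rpow_le_rpow_of_exponent_le (one_le_coe n) h

theorem powWeight_anti {s : ℝ} (h : s ≤ 0) {m n : ℕ+} (hmn : m ≤ n) :
    powWeight s n ≤ powWeight s m :=
  Real.rpow_le_rpow_of_nonpos (zero_lt_one.trans_le (one_le_coe m)) (by exact_mod_cast hmn) h

theorem exp_mul_logSeq (t : ℝ) (n : ℕ+) : Real.exp (t * logSeq n) = powWeight t n := by
  rw [powWeight, Real.rpow_def_of_pos (zero_lt_one.trans_le (one_le_coe n)), logSeq, mul_comm]

theorem norm_powWeight_mul (s : ℝ) (n : ℕ+) (z : ℂ) :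
    ‖(powWeight s n : ℂ) * z‖ = powWeight s n * ‖z‖ := by
  rw [norm_mul, Complex.norm_of_nonneg (powWeight_pos s n).le]

theorem powWeight_neg_mul_mul (s : ℝ) (n : ℕ+) (z : ℂ) :
    (powWeight (-s) n : ℂ) * ((powWeight s n : ℂ) * z) = z := by
  rw [← mul_assoc, ← Complex.ofReal_mul, powWeight_neg_mul, Complex.ofReal_one, one_mul]

theorem powWeight_mul_neg_mul (s : ℝ) (n : ℕ+) (z : ℂ) :
    (powWeight s n : ℂ) * ((powWeight (-s) n : ℂ) * z) = z := by
  simpa using powWeight_neg_mul_mul (-s) n z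

theorem tendsto_powWeight {s : ℝ} (h : s < 0) :
    Filter.Tendsto (fun n : ℕ => (n : ℝ) ^ s) Filter.atTop (𝓝 0) := by
  have := (tendsto_rpow_neg_atTop (neg_pos.2 h)).comp tendsto_natCast_atTop_atTop
  simpa [Function.comp_def] using this

/-! ### The spaces `d(q)` and weighted sup norms -/

theorem hat_antitone {x : ℕ+ → ℂ} (hx : Memℓp x ∞) : Antitone (hat x) := fun m _ hmn =>
  Real.iSup_le (fun k => norm_le_hat hx (hmn.trans k.2)) (hat_nonneg x m)

theorem hat_le {x : ℕ+ → ℂ} {n : ℕ+} {C : ℝ} (hC : 0 ≤ C) (h : ∀ k, n ≤ k → ‖x k‖ ≤ C) :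
    hat x n ≤ C :=
  Real.iSup_le (fun k => h k k.2) hC

theorem toReal_pos {q : ℝ≥0∞} (h1 : 1 < q) (h2 : q < ∞) : 0 < q.toReal :=
  ENNReal.toReal_pos (zero_lt_one.trans h1).ne' h2.ne

/-- The first `n` terms of the decreasing sequence `x̂` are all at least `x̂ₙ`, so the partial `ℓ_q`
sum is at least `n * x̂ₙ^q`. -/
theorem DSpace.powWeight_mul_norm_le {q : ℝ≥0∞} (h1 : 1 < q) (h2 : q < ∞) {s : ℝ}
    (hs : s ≤ q.toReal⁻¹) (x : DSpace q) (n : ℕ+) : powWeight s n * ‖x.1 n‖ ≤ ‖x‖ := by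
  have hq := toReal_pos h1 h2
  have hf : Fact (1 ≤ q) := ⟨h1.le⟩
  have hsum := lp.sum_rpow_le_norm_rpow hq (DSpace.hatLp x) (Finset.Icc 1 n)
  have hn : (n : ℝ) * hat x.1 n ^ q.toReal ≤ ‖x‖ ^ q.toReal := by
    refine le_trans ?_ hsum
    have : ∑ _i ∈ Finset.Icc 1 n, hat x.1 n ^ q.toReal = (n : ℝ) * hat x.1 n ^ q.toReal := by
      simp
    rw [← this]
    refine Finset.sum_le_sum fun i hi => ?_
    refine Real.rpow_le_rpow (hat_nonneg _ _) ?_ hq.le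
    exact (hat_antitone x.2.1 (Finset.mem_Icc.1 hi).2).trans (Real.le_norm_self _)
  have hxn : 0 ≤ ‖x‖ := norm_nonneg (DSpace.hatLp x)
  have h3 : powWeight q.toReal⁻¹ n * hat x.1 n ≤ ‖x‖ := by
    refine (Real.rpow_le_rpow_iff (mul_nonneg (powWeight_pos _ _).le (hat_nonneg _ _))
      hxn hq).1 ?_
    rw [Real.mul_rpow (powWeight_pos _ _).le (hat_nonneg _ _), powWeight,
      ← Real.rpow_mul (zero_le_one.trans (one_le_coe n)), inv_mul_cancel₀ hq.ne', Real.rpow_one]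
    exact hn
  calc powWeight s n * ‖x.1 n‖ ≤ powWeight q.toReal⁻¹ n * hat x.1 n :=
        mul_le_mul (powWeight_mono hs n) (norm_le_hat x.2.1 le_rfl) (norm_nonneg _)
          (powWeight_pos _ _).le
    _ ≤ ‖x‖ := h3

theorem memℓp_powWeight_neg {q : ℝ≥0∞} (h1 : 1 < q) (h2 : q < ∞) {s : ℝ}
    (hs : q.toReal⁻¹ < s) : Memℓp (powWeight (-s)) q := by
  have hq := toReal_pos h1 h2
  refine memℓp_gen ?_
  have h : Summable fun n : ℕ => (n : ℝ) ^ (-s * q.toReal) := by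
    rw [Real.summable_nat_rpow]
    have := mul_lt_mul_of_pos_right hs hq
    rw [inv_mul_cancel₀ hq.ne'] at this
    linarith
  refine (h.comp_injective PNat.coe_injective).congr fun n => ?_
  rw [Real.norm_of_nonneg (powWeight_pos _ _).le, powWeight, Function.comp_apply,
    ← Real.rpow_mul (zero_le_one.trans (one_le_coe n))]

/-- The majorant is itself decreasing, so it also dominates the least decreasing majorant. -/
theorem hat_le_mul_powWeight {s : ℝ} (hs : 0 ≤ s) {x : ℕ+ → ℂ} {c : ℝ} (hc : 0 ≤ c)
    (hx : ∀ n, ‖x n‖ ≤ c * powWeight (-s) n) (n : ℕ+) : hat x n ≤ c * powWeight (-s) n :=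
  hat_le (mul_nonneg hc (powWeight_pos _ _).le) fun k hk => (hx k).trans
    (mul_le_mul_of_nonneg_left (powWeight_anti (neg_nonpos.2 hs) hk) hc)

theorem mem_dSubmodule_of_le {q : ℝ≥0∞} (h1 : 1 < q) (h2 : q < ∞) {s : ℝ}
    (hs : q.toReal⁻¹ < s) {x : ℕ+ → ℂ} {c : ℝ} (hc : 0 ≤ c)
    (hx : ∀ n, ‖x n‖ ≤ c * powWeight (-s) n) : x ∈ dSubmodule q := by
  have hs0 : 0 ≤ s := (inv_nonneg.2 (toReal_pos h1 h2).le).trans hs.le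
  refine ⟨memℓp_infty ⟨c, ?_⟩, ((memℓp_powWeight_neg h1 h2 hs).const_smul c).mono fun n => ?_⟩
  · rintro _ ⟨n, rfl⟩
    refine (hx n).trans (mul_le_of_le_one_right hc ?_)
    exact (powWeight_mono (neg_nonpos.2 hs0) n).trans_eq (powWeight_zero n)
  · rw [Real.norm_of_nonneg (hat_nonneg _ _)]
    exact hat_le_mul_powWeight hs0 hc hx n

theorem DSpace.exists_norm_le {q : ℝ≥0∞} (h1 : 1 < q) (h2 : q < ∞) {s : ℝ}
    (hs : q.toReal⁻¹ < s) : ∃ K : ℝ, 0 ≤ K ∧ ∀ (x : DSpace q) (c : ℝ), 0 ≤ c →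
      (∀ n, ‖x.1 n‖ ≤ c * powWeight (-s) n) → ‖x‖ ≤ K * c := by
  have hf : Fact (1 ≤ q) := ⟨h1.le⟩
  have hs0 : 0 ≤ s := (inv_nonneg.2 (toReal_pos h1 h2).le).trans hs.le
  let w : lp (fun _ : ℕ+ => ℝ) q := ⟨powWeight (-s), memℓp_powWeight_neg h1 h2 hs⟩
  refine ⟨‖w‖, norm_nonneg _, fun x c hc hx => ?_⟩
  have : ‖DSpace.hatLp x‖ ≤ ‖c • w‖ := lp.norm_mono (DSpace.q_ne_zero q) fun n => by
    change ‖hat x.1 n‖ ≤ ‖c * powWeight (-s) n‖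
    rw [Real.norm_of_nonneg (hat_nonneg _ _),
      Real.norm_of_nonneg (mul_nonneg hc (powWeight_pos _ _).le)]
    exact hat_le_mul_powWeight hs0 hc hx n
  rwa [norm_smul, Real.norm_of_nonneg hc, mul_comm] at this

/-- The map `x ↦ (nˢ xₙ)ₙ` from `d(q)` to `ℓ_∞`, for `s ≤ 1 / q`. -/
def DSpace.toLinf {q : ℝ≥0∞} [Fact (1 ≤ q)] (h1 : 1 < q) (h2 : q < ∞) {s : ℝ}
    (hs : s ≤ q.toReal⁻¹) : DSpace q →L[ℂ] lp (fun _ : ℕ+ => ℂ) ∞ :=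
  LinearMap.mkContinuous
    { toFun := fun x => ⟨fun n => (powWeight s n : ℂ) * x.1 n, memℓp_infty ⟨‖x‖, by
        rintro _ ⟨n, rfl⟩
        simpa only [norm_powWeight_mul] using DSpace.powWeight_mul_norm_le h1 h2 hs x n⟩⟩
      map_add' := fun x y => Subtype.ext (funext fun n => mul_add _ (x.1 n) (y.1 n))
      map_smul' := fun c x => Subtype.ext (funext fun n => mul_left_comm _ c (x.1 n)) } 1
    fun x => by
      refine lp.norm_le_of_forall_le (by positivity) fun n => ?_
      rw [one_mul]
      exact (norm_powWeight_mul _ _ _).trans_le (DSpace.powWeight_mul_norm_le h1 h2 hs x n)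

theorem norm_powWeight_mul_lp_le (s : ℝ) (z : lp (fun _ : ℕ+ => ℂ) ∞) (n : ℕ+) :
    ‖(powWeight s n : ℂ) * z n‖ ≤ ‖z‖ * powWeight s n := by
  rw [norm_powWeight_mul, mul_comm]
  exact mul_le_mul_of_nonneg_right (lp.norm_apply_le_norm ENNReal.top_ne_zero z n)
    (powWeight_pos _ _).le

/-- The map `y ↦ (n⁻ˢ yₙ)ₙ` from `ℓ_∞` to `d(q)`, for `s > 1 / q`. -/
def DSpace.ofLinf {q : ℝ≥0∞} [Fact (1 ≤ q)] (h1 : 1 < q) (h2 : q < ∞) {s : ℝ}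
    (hs : q.toReal⁻¹ < s) : lp (fun _ : ℕ+ => ℂ) ∞ →L[ℂ] DSpace q :=
  LinearMap.mkContinuousOfExistsBound
    { toFun := fun z => ⟨fun n => (powWeight (-s) n : ℂ) * z n,
        mem_dSubmodule_of_le h1 h2 hs (norm_nonneg z) fun n => norm_powWeight_mul_lp_le _ z n⟩
      map_add' := fun x y => Subtype.ext (funext fun n => mul_add _ (x n) (y n))
      map_smul' := fun c x => Subtype.ext (funext fun n => mul_left_comm _ c (x n)) } <| by
    obtain ⟨K, _, h⟩ := DSpace.exists_norm_le h1 h2 hs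
    exact ⟨K, fun z => h _ _ (norm_nonneg z) fun n => norm_powWeight_mul_lp_le _ z n⟩

/-! ### Non-nuclearity -/

/-- The canonical map of `E` into the local Banach space of a seminorm. -/
def toLocalBanachSpace {E : Type*} [AddCommGroup E] [Module ℂ E] (p : Seminorm ℂ E) :
    E →ₗ[ℂ] LocalBanachSpace p :=
  ((Completion.toComplL : WithSeminorm p →L[ℂ] LocalBanachSpace p) :
    WithSeminorm p →ₗ[ℂ] LocalBanachSpace p)

theorem norm_toLocalBanachSpace {E : Type*} [AddCommGroup E] [Module ℂ E] (p : Seminorm ℂ E)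
    (x : E) : ‖toLocalBanachSpace p x‖ = p x :=
  Completion.norm_coe (E := WithSeminorm p) x

/-- The trace obstruction to nuclearity: if `(E, q) → (E, p)` is nuclear, `|f n| ≤ p` and the
vectors `e n` are unconditionally bounded for `q`, then `∑ |f n (e n)|` converges. -/
theorem exists_sum_norm_le_of_isNuclearMap {E ι : Type*} [AddCommGroup E] [Module ℂ E]
    {p q : Seminorm ℂ E} (h : p ≤ q) (hnuc : IsNuclearMap (linkingMap h))
    (f : ι → E →ₗ[ℂ] ℂ) (hf : ∀ n x, ‖f n x‖ ≤ p x) (e : ι → E) (K : ℝ)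
    (he : ∀ (s : Finset ι) (θ : ι → ℂ), (∀ n, ‖θ n‖ ≤ 1) → q (∑ n ∈ s, θ n • e n) ≤ K) :
    ∃ M : ℝ, ∀ s : Finset ι, ∑ n ∈ s, ‖f n (e n)‖ ≤ M := by
  obtain ⟨a, y, hsum, hT⟩ := hnuc
  let g : ι → WithSeminorm p →L[ℂ] ℂ := fun n =>
    LinearMap.mkContinuous (f n : WithSeminorm p →ₗ[ℂ] ℂ) 1
      fun x => by rw [one_mul]; exact hf n x
  let G : ι → LocalBanachSpace p →L[ℂ] ℂ := fun n => (g n).fromCompletion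
  have hGcoe : ∀ n x, G n (toLocalBanachSpace p x) = f n x := fun n x =>
    Completion.extension_coe (g n).uniformContinuous x
  have hG : ∀ n (z : LocalBanachSpace p), ‖G n z‖ ≤ ‖z‖ := fun n z => by
    have hle : ∀ x : E, ‖G n (toLocalBanachSpace p x)‖ ≤ ‖toLocalBanachSpace p x‖ := fun x => by
      rw [hGcoe, norm_toLocalBanachSpace]
      exact hf n x
    refine Completion.induction_on z
      (isClosed_le (G n).continuous.norm continuous_norm) fun x => ?_
    exact hle x
  -- Unimodular factors `θ` turn every term of `aᵢ(∑ θₙ eₙ)` into its absolute value, so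
  -- unconditional boundedness becomes an `ℓ_1` bound for each `aᵢ`.
  have hK : ∀ (i : ℕ) (s : Finset ι),
      ∑ n ∈ s, ‖a i (toLocalBanachSpace q (e n))‖ ≤ ‖a i‖ * K := by
    intro i s
    let z : ι → ℂ := fun n => a i (toLocalBanachSpace q (e n))
    have hθ : ∀ w : ℂ, ∃ θ : ℂ, ‖θ‖ ≤ 1 ∧ θ * w = (‖w‖ : ℂ) := fun w => by
      by_cases hw : w = 0
      · exact ⟨0, by simp, by simp [hw]⟩
      · have hw' : (‖w‖ : ℂ) ≠ 0 := by simpa using hw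
        refine ⟨(starRingEnd ℂ) w / ‖w‖, by simp [hw], ?_⟩
        rw [div_mul_eq_mul_div, mul_comm, Complex.mul_conj']
        field_simp
    choose θ hθ1 hθ2 using hθ
    let v : E := ∑ n ∈ s, θ (z n) • e n
    have hv : a i (toLocalBanachSpace q v) = ((∑ n ∈ s, ‖z n‖ : ℝ) : ℂ) := by
      rw [Complex.ofReal_sum, map_sum, map_sum]
      refine Finset.sum_congr rfl fun n _ => ?_
      rw [map_smul, map_smul, smul_eq_mul, hθ2]
    have h2 : q v ≤ K := he s (fun n => θ (z n)) fun n => hθ1 _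
    have h3 := (a i).le_opNorm (toLocalBanachSpace q v)
    rw [hv, Complex.norm_of_nonneg (Finset.sum_nonneg fun _ _ => norm_nonneg _),
      norm_toLocalBanachSpace] at h3
    exact h3.trans (mul_le_mul_of_nonneg_left h2 (norm_nonneg _))
  refine ⟨∑' i, ‖a i‖ * ‖y i‖ * K, fun s => ?_⟩
  -- The nuclear expansion of the diagonal entry `f n (e n)`; the sums over `n` and `i` are
  -- interchanged at the end.
  have hterm : ∀ n, HasSum (fun i => a i (toLocalBanachSpace q (e n)) * G n (y i))
      (f n (e n)) := fun n => by
    have h1 := (hT (toLocalBanachSpace q (e n))).mapL (G n)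
    have h2 : linkingMap h (toLocalBanachSpace q (e n))
        = toLocalBanachSpace p (e n) :=
      Completion.map_coe (changeSeminorm h).uniformContinuous _
    rw [h2, hGcoe] at h1
    simpa only [map_smul, smul_eq_mul] using h1
  have hbd : ∀ n i, ‖a i (toLocalBanachSpace q (e n)) * G n (y i)‖
      ≤ ‖a i (toLocalBanachSpace q (e n))‖ * ‖y i‖ := fun n i => by
    rw [norm_mul]
    exact mul_le_mul_of_nonneg_left (hG n _) (norm_nonneg _)
  have hsK : Summable fun i => ‖a i‖ * ‖y i‖ * K := hsum.mul_right K
  have hle : ∀ i, ∑ n ∈ s, ‖a i (toLocalBanachSpace q (e n))‖ * ‖y i‖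
      ≤ ‖a i‖ * ‖y i‖ * K := fun i => by
    rw [← Finset.sum_mul, mul_right_comm]
    exact mul_le_mul_of_nonneg_right (hK i s) (norm_nonneg _)
  have hsn : ∀ n ∈ s, Summable fun i =>
      ‖a i (toLocalBanachSpace q (e n))‖ * ‖y i‖ := fun n hn =>
    Summable.of_nonneg_of_le (fun i => by positivity) (fun i => (Finset.single_le_sum
      (f := fun n => ‖a i (toLocalBanachSpace q (e n))‖ * ‖y i‖)
      (fun _ _ => by positivity) hn).trans (hle i)) hsK
  calc ∑ n ∈ s, ‖f n (e n)‖
      ≤ ∑ n ∈ s, ∑' i, ‖a i (toLocalBanachSpace q (e n))‖ * ‖y i‖ :=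
        Finset.sum_le_sum fun n hn => by
          rw [← (hterm n).tsum_eq]
          exact tsum_of_norm_bounded (hsn n hn).hasSum (hbd n)
    _ = ∑' i, ∑ n ∈ s, ‖a i (toLocalBanachSpace q (e n))‖ * ‖y i‖ :=
        (Summable.tsum_finsetSum hsn).symm
    _ ≤ _ := Summable.tsum_le_tsum hle (summable_sum hsn) hsK

/-! ### Diagonal operators -/

section Diagonal

variable {s : ℝ≥0∞} [Fact (1 ≤ s)]

/-- Puts a coordinatewise bound in the form required by monotonicity of the `ℓ_s` norm, uniformly in
`s`. -/
theorem norm_le_norm_smul_of_forall {z w : ℕ+ → ℂ} {C : ℝ} (h : ∀ n, ‖w n‖ ≤ C * ‖z n‖) (n : ℕ+) :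
    ‖w n‖ ≤ ‖((C : ℂ) • z) n‖ := by
  have hC : C * ‖z n‖ ≤ |C| * ‖z n‖ := mul_le_mul_of_nonneg_right (le_abs_self C) (norm_nonneg _)
  simpa [norm_mul] using (h n).trans hC

/-- The diagonal operator on `ℓ_s` with bounded diagonal `w`. -/
def lpDiag (s : ℝ≥0∞) [Fact (1 ≤ s)] (w : ℕ+ → ℂ) (C : ℝ) (hC : 0 ≤ C) (hw : ∀ n, ‖w n‖ ≤ C) :
    lp (fun _ : ℕ+ => ℂ) s →L[ℂ] lp (fun _ : ℕ+ => ℂ) s :=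
  have hle : ∀ (z : lp (fun _ : ℕ+ => ℂ) s) n, ‖w n * z n‖ ≤ C * ‖z n‖ := fun z n => by
    rw [norm_mul]
    exact mul_le_mul_of_nonneg_right (hw n) (norm_nonneg _)
  LinearMap.mkContinuous
    { toFun := fun z => ⟨fun n => w n * z n,
        ((lp.memℓp z).const_smul (C : ℂ)).mono'
          (norm_le_norm_smul_of_forall (z := z) (w := fun n => w n * z n) (hle z))⟩
      map_add' := fun x y => Subtype.ext (funext fun n => mul_add _ (x n) (y n))
      map_smul' := fun c x => Subtype.ext (funext fun n => mul_left_comm _ c (x n)) } C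
    fun z => by
      have h := lp.norm_mono (DSpace.q_ne_zero s) (x := (⟨fun n => w n * z n,
        ((lp.memℓp z).const_smul (C : ℂ)).mono' (norm_le_norm_smul_of_forall (z := z)
          (w := fun n => w n * z n) (hle z))⟩ : lp (fun _ : ℕ+ => ℂ) s)) (y := (C : ℂ) • z)
        (norm_le_norm_smul_of_forall (hle z))
      rwa [norm_smul, Complex.norm_of_nonneg hC] at h

theorem lpDiag_apply (w : ℕ+ → ℂ) (C : ℝ) (hC : 0 ≤ C) (hw : ∀ n, ‖w n‖ ≤ C)
    (z : lp (fun _ : ℕ+ => ℂ) s) (n : ℕ+) : lpDiag s w C hC hw z n = w n * z n := rfl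

/-- The finite rank operator that multiplies the coordinates in `F` by `w` and kills the others. -/
def lpDiagFinset (s : ℝ≥0∞) [Fact (1 ≤ s)] (w : ℕ+ → ℂ) (F : Finset ℕ+) :
    lp (fun _ : ℕ+ => ℂ) s →L[ℂ] lp (fun _ : ℕ+ => ℂ) s :=
  ∑ n ∈ F, (lp.singleContinuousLinearMap ℂ (fun _ : ℕ+ => ℂ) s n).comp
    (w n • lp.evalCLM ℂ (fun _ : ℕ+ => ℂ) s n)

theorem lpDiagFinset_apply (w : ℕ+ → ℂ) (F : Finset ℕ+)
    (z : lp (fun _ : ℕ+ => ℂ) s) (n : ℕ+) :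
    lpDiagFinset s w F z n = (if n ∈ F then w n else 0) * z n := by
  have h : lpDiagFinset s w F z = ∑ k ∈ F, lp.single (E := fun _ : ℕ+ => ℂ) s k (w k * z k) := by
    rw [lpDiagFinset, sum_apply]
    rfl
  rw [h, lp.coeFn_sum, Finset.sum_apply]
  simp [Pi.single_apply, ite_mul]

theorem isCompactOperator_lpDiagFinset (w : ℕ+ → ℂ) (F : Finset ℕ+) :
    IsCompactOperator (lpDiagFinset s w F) := by
  refine Finset.sum_induction _ (fun T : lp (fun _ : ℕ+ => ℂ) s →L[ℂ] lp (fun _ : ℕ+ => ℂ) s =>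
    IsCompactOperator T) (fun _ _ h1 h2 => h1.add h2) isCompactOperator_zero fun n _ => ?_
  exact (isCompactOperator_of_locallyCompactSpace_rng
    (lp.singleContinuousLinearMap ℂ (fun _ : ℕ+ => ℂ) s n)).comp_clm _

/-- A null diagonal is the limit in operator norm of its finite-rank truncations. -/
theorem isCompactOperator_lpDiag (w : ℕ+ → ℂ) (C : ℝ) (hC : 0 ≤ C) (hw : ∀ n, ‖w n‖ ≤ C)
    (h0 : Filter.Tendsto w Filter.cofinite (𝓝 0)) : IsCompactOperator (lpDiag s w C hC hw) := by
  refine isCompactOperator_of_tendsto (F := lpDiagFinset s w) (l := Filter.atTop) ?_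
    (Filter.Eventually.of_forall (isCompactOperator_lpDiagFinset w))
  rw [Metric.tendsto_atTop]
  intro ε hε
  have hfin : {n | ¬ ‖w n‖ < ε / 2}.Finite := by
    have := h0.norm
    rw [norm_zero] at this
    exact this.eventually (gt_mem_nhds (half_pos hε))
  refine ⟨hfin.toFinset, fun F hF => ?_⟩
  rw [dist_eq_norm]
  refine lt_of_le_of_lt (ContinuousLinearMap.opNorm_le_bound _ (half_pos hε).le fun z => ?_)
    (half_lt_self hε)
  have h := lp.norm_mono (DSpace.q_ne_zero s) (x := lpDiagFinset s w F z - lpDiag s w C hC hw z)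
    (y := ((ε / 2 : ℝ) : ℂ) • z) (norm_le_norm_smul_of_forall fun n => ?_)
  · rwa [norm_smul, Complex.norm_of_nonneg (half_pos hε).le] at h
  · rw [lp.coeFn_sub, Pi.sub_apply, lpDiagFinset_apply, lpDiag_apply, ← sub_mul, norm_mul]
    refine mul_le_mul_of_nonneg_right ?_ (norm_nonneg _)
    split_ifs with hn
    · simpa using (half_pos hε).le
    · rw [zero_sub, norm_neg]
      by_contra hcon
      exact hn (hF (hfin.mem_toFinset.2 fun h => hcon h.le))

end Diagonal

/-! ### The power series spaces are Fréchet–Schwartz spaces -/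

theorem tendsto_powWeight_cofinite {s : ℝ} (h : s < 0) :
    Filter.Tendsto (fun n : ℕ+ => (powWeight s n : ℂ)) Filter.cofinite (𝓝 0) := by
  have h1 := (tendsto_powWeight h).comp
    (Nat.cofinite_eq_atTop ▸ PNat.coe_injective.tendsto_cofinite)
  exact (Complex.continuous_ofReal.tendsto' 0 0 Complex.ofReal_zero).comp h1

namespace PowerSeriesSpace

variable {s : ℝ≥0∞} [Fact (1 ≤ s)]

omit [Fact (1 ≤ s)] in
theorem weightMap_apply (t : Set.Iio (0 : ℝ)) (x : PowerSeriesSpace s 0 logSeq) (n : ℕ+) :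
    weightMap t x n = (powWeight t.1 n : ℂ) * x.1 n := by
  rw [← exp_mul_logSeq]
  rfl

theorem norm_powWeight_le_one {t : ℝ} (ht : t ≤ 0) (n : ℕ+) : ‖(powWeight t n : ℂ)‖ ≤ 1 := by
  rw [Complex.norm_of_nonneg (powWeight_pos _ _).le]
  exact (powWeight_mono ht n).trans_eq (powWeight_zero n)

/-- The diagonal `n^{t-t'}` is at most `1`, which makes the defining norms directed; for `t < t'` it
is null, which gives the Schwartz property. -/
theorem weightMap_eq_lpDiag {t t' : Set.Iio (0 : ℝ)} (h : t ≤ t')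
    (x : PowerSeriesSpace s 0 logSeq) :
    weightMap t x = lpDiag s (fun n => powWeight (t.1 - t'.1) n) 1 zero_le_one
      (norm_powWeight_le_one (sub_nonpos.2 h)) (weightMap t' x) := by
  refine lp.ext (funext fun n => ?_)
  rw [lpDiag_apply, weightMap_apply, weightMap_apply, ← mul_assoc, ← Complex.ofReal_mul,
    ← powWeight_add, sub_add_cancel]

theorem induced_weightMap_anti {t t' : Set.Iio (0 : ℝ)} (h : t ≤ t') :
    TopologicalSpace.induced (weightMap (s := s) (α := logSeq) t') inferInstance
      ≤ .induced (weightMap t) inferInstance := by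
  have : (weightMap t : PowerSeriesSpace s 0 logSeq → _) = _ ∘ weightMap t' :=
    funext fun x => weightMap_eq_lpDiag h x
  rw [this, ← induced_compose]
  exact induced_mono (lpDiag s _ _ _ _).continuous.le_induced

/-- The exponents `-1 / (k + 1)`, cofinal among the negative numbers. -/
def negInv (k : ℕ) : Set.Iio (0 : ℝ) := ⟨-(1 / ((k : ℝ) + 1)), neg_neg_of_pos (by positivity : (0 : ℝ) < 1 / ((k : ℝ) + 1))⟩

theorem exists_le_negInv (t : Set.Iio (0 : ℝ)) : ∃ k, t ≤ negInv k := by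
  obtain ⟨k, hk⟩ := exists_nat_one_div_lt (K := ℝ) (neg_pos.2 (t.2 : t.1 < 0))
  exact ⟨k, show t.1 ≤ -(1 / ((k : ℝ) + 1)) from (lt_neg.1 hk).le⟩

theorem topology_eq_iInf_negInv : (inferInstance : TopologicalSpace (PowerSeriesSpace s 0 logSeq))
    = ⨅ k : ℕ, .induced (weightMap (negInv k)) inferInstance :=
  le_antisymm (le_iInf fun k => iInf_le _ (negInv k)) <| le_iInf fun t => by
    obtain ⟨k, hk⟩ := exists_le_negInv t
    exact (iInf_le _ k).trans (induced_weightMap_anti hk)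

/-- The embedding of the power series space into a countable product of Banach spaces. -/
def toPi (s : ℝ≥0∞) [Fact (1 ≤ s)] :
    PowerSeriesSpace s 0 logSeq →ₗ[ℂ] ℕ → lp (fun _ : ℕ+ => ℂ) s :=
  LinearMap.pi fun k => weightMap (negInv k)

theorem isInducing_toPi : Topology.IsInducing (toPi s) := by
  have := inducing_iInf_to_pi fun (k : ℕ) (x : PowerSeriesSpace s 0 logSeq) =>
    weightMap (negInv k) x
  rwa [← topology_eq_iInf_negInv] at this

omit [Fact (1 ≤ s)] in
theorem weightMap_injective (t : Set.Iio (0 : ℝ)) :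
    Function.Injective (weightMap (s := s) (α := logSeq) t) := fun x y h => by
  refine Subtype.ext (funext fun n => ?_)
  have h1 : weightMap t x n = weightMap t y n := by rw [h]
  rw [weightMap_apply, weightMap_apply] at h1
  exact mul_left_cancel₀ (Complex.ofReal_ne_zero.2 (powWeight_pos _ n).ne') h1

theorem isEmbedding_toPi : Topology.IsEmbedding (toPi s) :=
  ⟨isInducing_toPi, fun _ _ h => weightMap_injective (negInv 0) (congrFun h 0)⟩

/-- The range consists of the families for which `n^{-tₖ} zₖ(n)` does not depend on `k`, a closed
condition on coordinates. Membership for an arbitrary `t < 0` follows by comparison with some `tₖ ≥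
t`. -/
theorem isClosed_range_toPi : IsClosed (Set.range (toPi s)) := by
  have heq : Set.range (toPi s) = ⋂ (k : ℕ) (n : ℕ+), {z | (powWeight (-(negInv k).1) n : ℂ) * z k n
      = (powWeight (-(negInv 0).1) n : ℂ) * z 0 n} := by
    ext z
    simp only [Set.mem_range, Set.mem_iInter, Set.mem_ofPred_eq]
    constructor
    · rintro ⟨x, rfl⟩ k n
      change _ * weightMap (negInv k) x n = _ * weightMap (negInv 0) x n
      rw [weightMap_apply, weightMap_apply, powWeight_neg_mul_mul, powWeight_neg_mul_mul]
    · intro h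
      have hz : ∀ k n, (powWeight (negInv k).1 n : ℂ) *
          ((powWeight (-(negInv 0).1) n : ℂ) * z 0 n) = z k n := fun k n => by
        rw [← h k n, powWeight_mul_neg_mul]
      refine ⟨⟨fun n => (powWeight (-(negInv 0).1) n : ℂ) * z 0 n, fun t ht => ?_⟩, ?_⟩
      · obtain ⟨k, hk⟩ := exists_le_negInv ⟨t, ht⟩
        refine (lp.memℓp (z k)).mono' fun n => ?_
        rw [← hz k n, exp_mul_logSeq, norm_powWeight_mul _ _ (_ * _),
          norm_powWeight_mul _ _ (_ * _)]
        exact mul_le_mul_of_nonneg_right (powWeight_mono hk n) (norm_nonneg _)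
      · refine funext fun k => lp.ext (funext fun n => ?_)
        change weightMap (negInv k) _ n = _
        exact (weightMap_apply _ _ n).trans (hz k n)
  rw [heq]
  refine isClosed_iInter fun k => isClosed_iInter fun n => isClosed_eq ?_ ?_
  · exact continuous_const.mul
      ((lp.evalCLM ℂ (fun _ : ℕ+ => ℂ) s n).continuous.comp (continuous_apply k))
  · exact continuous_const.mul
      ((lp.evalCLM ℂ (fun _ : ℕ+ => ℂ) s n).continuous.comp (continuous_apply 0))

theorem isFrechetSpace : IsFrechetSpace (PowerSeriesSpace s 0 logSeq) where
  locallyConvex := inferInstance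
  hausdorff := isEmbedding_toPi.t2Space
  firstCountable := isInducing_toPi.firstCountableTopology
  complete := by
    let := IsTopologicalAddGroup.rightUniformSpace (PowerSeriesSpace s 0 logSeq)
    have := isUniformAddGroup_of_addCommGroup (G := PowerSeriesSpace s 0 logSeq)
    exact (completeSpace_iff_isComplete_range
      (AddMonoidHom.isUniformInducing_of_isInducing isInducing_toPi)).2
        isClosed_range_toPi.isComplete

theorem exists_weightMap_subset {U : Set (PowerSeriesSpace s 0 logSeq)} (hU : U ∈ 𝓝 0) :
    ∃ (t : Set.Iio (0 : ℝ)) (ε : ℝ), 0 < ε ∧ ∀ x, ‖weightMap t x‖ < ε → x ∈ U := by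
  have : Nonempty (Set.Iio (0 : ℝ)) := ⟨negInv 0⟩
  rw [show 𝓝 (0 : PowerSeriesSpace s 0 logSeq) = ⨅ t : Set.Iio (0 : ℝ),
    @nhds _ (.induced (weightMap t) inferInstance) 0 from nhds_iInf,
    Filter.mem_iInf_of_directed] at hU
  · obtain ⟨t, ht⟩ := hU
    rw [nhds_induced, map_zero] at ht
    obtain ⟨V, hV, hVU⟩ := Filter.mem_comap.1 ht
    obtain ⟨ε, hε, h⟩ := Metric.mem_nhds_iff.1 hV
    exact ⟨t, ε, hε, fun x hx => hVU (h (mem_ball_zero_iff.2 hx))⟩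
  · exact Antitone.directed_ge fun t t' h => nhds_mono (induced_weightMap_anti h)

theorem continuous_weightMap (t : Set.Iio (0 : ℝ)) :
    Continuous (weightMap (s := s) (α := logSeq) t) :=
  continuous_iff_le_induced.2 (iInf_le _ t)

theorem isSchwartzSpace : IsSchwartzSpace (PowerSeriesSpace s 0 logSeq) := by
  intro U hU
  obtain ⟨t, δ, hδ, hUt⟩ := exists_weightMap_subset hU
  -- Any exponent strictly between `t` and `0` would do: the diagonal `n^{t-t'}` is then compact.
  let t' : Set.Iio (0 : ℝ) := ⟨t.1 / 2, by have := t.2; simp only [Set.mem_Iio] at this ⊢; linarith⟩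
  have htt : t.1 < t'.1 := by have := t.2; simp only [Set.mem_Iio, t'] at this ⊢; linarith
  let V : Set (PowerSeriesSpace s 0 logSeq) := {x | ‖weightMap t' x‖ < 1}
  have hV : V ∈ 𝓝 0 := by
    refine (isOpen_Iio.preimage (continuous_weightMap t').norm).mem_nhds ?_
    simp
  refine ⟨V, hV, fun ε hε => ?_⟩
  have htb : TotallyBounded (weightMap t '' V) := by
    obtain ⟨K, hK, hsub⟩ := (isCompactOperator_lpDiag (s := s) (fun n => powWeight (t.1 - t'.1) n) 1
      zero_le_one (norm_powWeight_le_one (sub_nonpos.2 htt.le))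
      (tendsto_powWeight_cofinite (sub_neg.2 htt))).image_ball_subset_compact 1
    refine hK.totallyBounded.subset ?_
    rintro _ ⟨x, hx, rfl⟩
    refine hsub ⟨weightMap t' x, mem_ball_zero_iff.2 hx, ?_⟩
    exact (weightMap_eq_lpDiag (t := t) (t' := t') htt.le x).symm
  obtain ⟨F, hFV, hF, hcov⟩ := Metric.finite_approx_of_totallyBounded htb (ε * δ) (by positivity)
  classical
  -- The centres of the `ε δ`-balls lie in the range of `weightMap t`, so `invFun` lifts them to
  -- genuine preimages.
  refine ⟨hF.toFinset.image (Function.invFun (weightMap (s := s) (α := logSeq) t)), fun v hv => ?_⟩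
  obtain ⟨z, hz, hvz⟩ := Set.mem_iUnion₂.1 (hcov ⟨v, hv, rfl⟩)
  have hz' : weightMap t (Function.invFun (weightMap (s := s) (α := logSeq) t) z) = z := by
    obtain ⟨x, _, hx⟩ := hFV hz
    exact Function.invFun_eq ⟨x, hx⟩
  have hε' : (ε : ℂ) ≠ 0 := Complex.ofReal_ne_zero.2 hε.ne'
  refine ⟨_, Finset.mem_image_of_mem _ (hF.mem_toFinset.2 hz),
    (ε : ℂ)⁻¹ • (v - Function.invFun (weightMap (s := s) (α := logSeq) t) z), hUt _ ?_, ?_⟩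
  · rw [map_smul, map_sub, hz', norm_smul, norm_inv, Complex.norm_of_nonneg hε.le,
      ← dist_eq_norm, inv_mul_lt_iff₀ hε]
    exact hvz
  · rw [smul_inv_smul₀ hε', add_sub_cancel]

theorem isFrechetSchwartzSpace : IsFrechetSchwartzSpace (PowerSeriesSpace s 0 logSeq) :=
  ⟨isFrechetSpace, isSchwartzSpace⟩

end PowerSeriesSpace

/-! ### Transfer of the Fréchet–Schwartz property -/

section Transfer

variable {E F : Type*} [AddCommGroup E] [Module ℂ E] [TopologicalSpace E]
  [IsTopologicalAddGroup E] [AddCommGroup F] [Module ℂ F] [TopologicalSpace F]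
  [IsTopologicalAddGroup F]

theorem IsFrechetSpace.of_equiv [PolynormableSpace ℂ E] (e : E ≃L[ℂ] F) (h : IsFrechetSpace F) :
    IsFrechetSpace E where
  locallyConvex := inferInstance
  hausdorff := have := h.hausdorff; e.toHomeomorph.symm.t2Space
  firstCountable := have := h.firstCountable; e.toHomeomorph.isInducing.firstCountableTopology
  complete := by
    let := IsTopologicalAddGroup.rightUniformSpace E
    have := isUniformAddGroup_of_addCommGroup (G := E)
    let := IsTopologicalAddGroup.rightUniformSpace F
    have := isUniformAddGroup_of_addCommGroup (G := F)
    exact ((AddMonoidHom.isUniformInducing_of_isInducing (f := e)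
      e.toHomeomorph.isInducing).completeSpace_congr e.surjective).2 h.complete

omit [IsTopologicalAddGroup E] [IsTopologicalAddGroup F] in
theorem IsSchwartzSpace.of_equiv (e : E ≃L[ℂ] F) (h : IsSchwartzSpace F) :
    IsSchwartzSpace E := by
  classical
  intro U hU
  have hU' : e.symm ⁻¹' U ∈ 𝓝 (0 : F) :=
    e.symm.continuous.continuousAt.preimage_mem_nhds (by rwa [map_zero])
  obtain ⟨V, hV, hc⟩ := h _ hU'
  refine ⟨e ⁻¹' V, e.continuous.continuousAt.preimage_mem_nhds (by rwa [map_zero]),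
    fun ε hε => ?_⟩
  obtain ⟨S, hS⟩ := hc ε hε
  refine ⟨S.image e.symm, fun v hv => ?_⟩
  obtain ⟨x, hx, u, hu, hvx⟩ := hS _ hv
  refine ⟨_, Finset.mem_image_of_mem _ hx, _, hu, ?_⟩
  rw [← map_smul, ← map_add, ← hvx, e.symm_apply_apply]

theorem IsFrechetSchwartzSpace.of_equiv [PolynormableSpace ℂ E] (e : E ≃L[ℂ] F)
    (h : IsFrechetSchwartzSpace F) : IsFrechetSchwartzSpace E :=
  ⟨h.frechet.of_equiv e, h.schwartz.of_equiv e⟩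

end Transfer

/-! ### A non-nuclearity criterion for sequence spaces -/

/-- The trace obstruction for the coordinate functionals and the vectors `n⁻¹ eₙ`: all sums `∑ θₙ
n⁻¹ eₙ` with `|θₙ| ≤ 1` are dominated by `1/n`, and the diagonal entries are `1/n`. -/
theorem not_isNuclearSpace_of_harmonic {E : Type*} [AddCommGroup E] [Module ℂ E]
    [TopologicalSpace E] (val : E →ₗ[ℂ] ℕ+ → ℂ) (p : Seminorm ℂ E) (hp : Continuous p)
    (hval : ∀ x n, ‖val x n‖ ≤ p x) (e : ℕ+ → E)
    (he : ∀ n, val (e n) = Pi.single n (powWeight (-1) n : ℂ))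
    (hbd : ∀ q : Seminorm ℂ E, Continuous q →
      ∃ K : ℝ, ∀ x, (∀ n, ‖val x n‖ ≤ powWeight (-1) n) → q x ≤ K) :
    ¬ IsNuclearSpace E := by
  intro hnuc
  obtain ⟨q, hq, h, hT⟩ := hnuc p hp
  obtain ⟨K, hK⟩ := hbd q hq
  obtain ⟨M, hM⟩ := exists_sum_norm_le_of_isNuclearMap h hT
    (fun n => (LinearMap.proj n).comp val) (fun n x => hval x n) e K fun s θ hθ => by
      refine hK _ fun n => ?_
      simp only [map_sum, map_smul, he, Finset.sum_apply, Pi.smul_apply, Pi.single_apply,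
        smul_eq_mul, mul_ite, mul_zero, Finset.sum_ite_eq]
      split_ifs
      · rw [mul_comm, norm_powWeight_mul]
        exact mul_le_of_le_one_right (powWeight_pos _ _).le (hθ n)
      · simpa using (powWeight_pos _ _).le
  have hsum : Summable fun n : ℕ+ => powWeight (-1) n := by
    refine summable_of_sum_le (c := M) (fun n => (powWeight_pos _ _).le) fun s => ?_
    refine le_trans (Finset.sum_le_sum fun n _ => ?_) (hM s)
    rw [LinearMap.comp_apply, he, LinearMap.proj_apply, Pi.single_eq_same,
      Complex.norm_of_nonneg (powWeight_pos _ _).le]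
  have hnat : Summable fun n : ℕ => ((n : ℝ) + 1) ^ (-1 : ℝ) := by
    refine (hsum.comp_injective Equiv.pnatEquivNat.symm.injective).congr fun n => ?_
    simp [powWeight, Equiv.pnatEquivNat]
  have := (summable_nat_add_iff (f := fun n : ℕ => (n : ℝ) ^ (-1 : ℝ)) 1).1 (by
    simpa using hnat)
  rw [Real.summable_nat_rpow] at this
  exact lt_irrefl _ this

namespace PowerSeriesSpace

variable {s : ℝ≥0∞} [Fact (1 ≤ s)]

theorem exists_seminorm_le (q : Seminorm ℂ (PowerSeriesSpace s 0 logSeq)) (hq : Continuous q) :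
    ∃ (t : Set.Iio (0 : ℝ)) (C : ℝ), 0 ≤ C ∧ ∀ x, q x ≤ C * ‖weightMap t x‖ := by
  obtain ⟨t, ε, hε, h⟩ := exists_weightMap_subset (U := {x | q x < 1})
    ((isOpen_Iio.preimage hq).mem_nhds (by simp))
  -- For `x ≠ 0`, rescaling to norm `ε / 2` meets the strict bound `< ε`; hence the factor `2`.
  refine ⟨t, 2 / ε, by positivity, fun x => ?_⟩
  by_cases hx : x = 0
  · simp [hx]
  have hw : 0 < ‖weightMap t x‖ := norm_pos_iff.2 fun h0 =>
    hx (weightMap_injective t (h0.trans (map_zero _).symm))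
  have hc : 0 ≤ ε / (2 * ‖weightMap t x‖) := by positivity
  have h1 := h (((ε / (2 * ‖weightMap t x‖) : ℝ) : ℂ) • x) (by
    rw [map_smul, norm_smul, Complex.norm_of_nonneg hc]
    field_simp
    linarith)
  have h2 : ε / (2 * ‖weightMap t x‖) * q x < 1 := by
    have := h1
    rwa [Set.mem_ofPred_eq, map_smul_eq_mul, Complex.norm_of_nonneg hc] at this
  rw [div_mul_eq_mul_div, div_lt_one (by positivity)] at h2
  rw [div_mul_eq_mul_div, le_div_iff₀ hε]
  linarith

end PowerSeriesSpace

/-! ### The spaces `d(p+)` -/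

theorem exists_plusIndex {p : ℝ≥0∞} (h1 : 1 ≤ p) (hp : p < ∞) {u : ℝ} (hu : u < p.toReal⁻¹) :
    ∃ q : PlusIndex p, u ≤ q.1.toReal⁻¹ := by
  have hp1 : 1 ≤ p.toReal := by
    rwa [← ENNReal.toReal_one, ENNReal.toReal_le_toReal ENNReal.one_ne_top hp.ne]
  have hp0 : 0 < p.toReal := zero_lt_one.trans_le hp1
  -- The exponent is `q = 1 / v`; taking `v` above `0` as well as above `u` allows negative `u`.
  obtain ⟨v, hv1, hv2⟩ := exists_between (max_lt hu (inv_pos.2 hp0))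
  have hv0 : 0 < v := (le_max_right _ _).trans_lt hv1
  have hpv : p < ENNReal.ofReal v⁻¹ := by
    rw [ENNReal.lt_ofReal_iff_toReal_lt hp.ne]
    exact (lt_inv_comm₀ hp0 hv0).2 hv2
  refine ⟨⟨ENNReal.ofReal v⁻¹, h1.trans_lt hpv, hpv, ENNReal.ofReal_lt_top⟩, ?_⟩
  rw [ENNReal.toReal_ofReal (inv_pos.2 hv0).le, inv_inv]
  exact (le_max_left _ _).trans hv1.le

theorem PlusIndex.toReal_inv_lt {p : ℝ≥0∞} (h1 : 1 ≤ p) (q : PlusIndex p) :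
    q.1.toReal⁻¹ < p.toReal⁻¹ := by
  have hp : p < ∞ := q.2.2.1.trans q.2.2.2
  exact inv_strictAnti₀ (ENNReal.toReal_pos (zero_lt_one.trans_le h1).ne' hp.ne)
    ((ENNReal.toReal_lt_toReal hp.ne q.2.2.2.ne).2 q.2.2.1)

namespace DPlus

variable {p : ℝ≥0∞}

theorem continuous_incl (q : PlusIndex p) : Continuous (incl q) :=
  continuous_iff_le_induced.2 (iInf_le _ q)

theorem powWeight_mul_mem (h1 : 1 ≤ p) (hp : p < ∞) (x : DPlus p) :
    (fun n => (powWeight p.toReal⁻¹ n : ℂ) * x.1 n) ∈ powerSeriesSubmodule ∞ 0 logSeq := by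
  intro t ht
  -- The combined weight is `n^{1/p+t}`, and `1/p + t < 1/p` leaves room for some `q > p`.
  obtain ⟨q, hq⟩ := exists_plusIndex h1 hp (add_lt_of_neg_right p.toReal⁻¹ ht)
  refine (lp.memℓp (DSpace.toLinf q.2.1 q.2.2.2 hq (incl q x))).mono' fun n => ?_
  change _ ≤ ‖(powWeight (p.toReal⁻¹ + t) n : ℂ) * x.1 n‖
  rw [exp_mul_logSeq, ← mul_assoc, ← Complex.ofReal_mul, ← powWeight_add, add_comm]

theorem powWeight_neg_mul_mem (h1 : 1 ≤ p) (y : PowerSeriesSpace ∞ 0 logSeq) :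
    (fun n => (powWeight (-p.toReal⁻¹) n : ℂ) * y.1 n) ∈ dPlusSubmodule p := by
  refine (Submodule.mem_iInf _).2 fun q => ?_
  -- Here `1/q - 1/p < t < 0`, so `s = 1/p + t` still exceeds `1/q`.
  obtain ⟨t, ht1, ht2⟩ := exists_between (sub_neg.2 (q.toReal_inv_lt h1))
  refine mem_dSubmodule_of_le q.2.1 q.2.2.2 (s := p.toReal⁻¹ + t) (by linarith)
    (norm_nonneg (PowerSeriesSpace.weightMap ⟨t, ht2⟩ y)) fun n => ?_
  have h := norm_powWeight_mul_lp_le (-(p.toReal⁻¹ + t)) (PowerSeriesSpace.weightMap ⟨t, ht2⟩ y) n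
  rwa [PowerSeriesSpace.weightMap_apply, ← mul_assoc, ← Complex.ofReal_mul, ← powWeight_add,
    neg_add, neg_add_cancel_right, ← neg_add] at h

/-- The diagonal isomorphism of vector spaces `x ↦ (n^{1/p} xₙ)ₙ` between `d(p+)` and
`Λ^∞_0(log n)`. -/
def toPowerSeries (h1 : 1 ≤ p) (hp : p < ∞) : DPlus p ≃ₗ[ℂ] PowerSeriesSpace ∞ 0 logSeq where
  toFun x := ⟨_, powWeight_mul_mem h1 hp x⟩
  map_add' x y := Subtype.ext (funext fun n => mul_add _ (x.1 n) (y.1 n))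
  map_smul' c x := Subtype.ext (funext fun n => mul_left_comm _ c (x.1 n))
  invFun y := ⟨_, powWeight_neg_mul_mem h1 y⟩
  left_inv x := Subtype.ext (funext fun n => powWeight_neg_mul_mul _ n (x.1 n))
  right_inv y := Subtype.ext (funext fun n => powWeight_mul_neg_mul _ n (y.1 n))

/-- `d(p+)` is isomorphic to `Λ^∞_0(log n)`. -/
def equivPowerSeries (h1 : 1 ≤ p) (hp : p < ∞) : DPlus p ≃L[ℂ] PowerSeriesSpace ∞ 0 logSeq where
  toLinearEquiv := toPowerSeries h1 hp
  continuous_toFun := by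
    refine continuous_iInf_rng.2 fun t => continuous_induced_rng.2 ?_
    obtain ⟨q, hq⟩ := exists_plusIndex h1 hp (add_lt_of_neg_right p.toReal⁻¹ t.2)
    refine ((DSpace.toLinf q.2.1 q.2.2.2 hq).continuous.comp (continuous_incl q)).congr
      fun x => lp.ext (funext fun n => ?_)
    change (powWeight (p.toReal⁻¹ + t) n : ℂ) * x.1 n = (Real.exp (t.1 * logSeq n) : ℂ) *
      ((powWeight p.toReal⁻¹ n : ℂ) * x.1 n)
    rw [exp_mul_logSeq, ← mul_assoc, ← Complex.ofReal_mul, ← powWeight_add, add_comm]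
  continuous_invFun := by
    refine continuous_iInf_rng.2 fun q => continuous_induced_rng.2 ?_
    obtain ⟨t, ht1, ht2⟩ := exists_between (sub_neg.2 (q.toReal_inv_lt h1))
    refine ((DSpace.ofLinf q.2.1 q.2.2.2 (s := p.toReal⁻¹ + t) (by linarith)).continuous.comp
      (PowerSeriesSpace.continuous_weightMap ⟨t, ht2⟩)).congr
      fun y => Subtype.ext (funext fun n => ?_)
    change (powWeight (-(p.toReal⁻¹ + t)) n : ℂ) * ((Real.exp (t * logSeq n) : ℂ) * y.1 n)
      = (powWeight (-p.toReal⁻¹) n : ℂ) * y.1 n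
    rw [exp_mul_logSeq, ← mul_assoc, ← Complex.ofReal_mul, ← powWeight_add, neg_add,
      neg_add_cancel_right]

theorem isFrechetSchwartzSpace (h1 : 1 ≤ p) (hp : p < ∞) : IsFrechetSchwartzSpace (DPlus p) :=
  PowerSeriesSpace.isFrechetSchwartzSpace.of_equiv (equivPowerSeries h1 hp)

theorem single_mem (n : ℕ+) (c : ℂ) : (Pi.single n c : ℕ+ → ℂ) ∈ dPlusSubmodule p := by
  refine (Submodule.mem_iInf _).2 fun q => ?_
  refine mem_dSubmodule_of_le q.2.1 q.2.2.2 (lt_add_one _)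
    (c := ‖c‖ / powWeight (-(q.1.toReal⁻¹ + 1)) n) (div_nonneg (norm_nonneg _)
    (powWeight_pos _ _).le) fun k => ?_
  by_cases h : k = n
  · subst h
    rw [Pi.single_eq_same, div_mul_cancel₀ _ (powWeight_pos _ _).ne']
  · rw [Pi.single_eq_of_ne h, norm_zero]
    exact mul_nonneg (div_nonneg (norm_nonneg _) (powWeight_pos _ _).le) (powWeight_pos _ _).le

theorem not_isNuclearSpace (h1 : 1 ≤ p) (hp : p < ∞) : ¬ IsNuclearSpace (DPlus p) := by
  have hP : 0 < p.toReal⁻¹ :=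
    inv_pos.2 (ENNReal.toReal_pos (zero_lt_one.trans_le h1).ne' hp.ne)
  have hP1 : p.toReal⁻¹ ≤ 1 := inv_le_one_of_one_le₀ (by
    rwa [← ENNReal.toReal_one, ENNReal.toReal_le_toReal ENNReal.one_ne_top hp.ne])
  -- With weight exponent `0`, `toLinf` gives the plain sup norm, which dominates every coordinate.
  obtain ⟨q, hq⟩ := exists_plusIndex h1 hp hP
  let L := DSpace.toLinf q.2.1 q.2.2.2 hq
  let p₀ : Seminorm ℂ (DPlus p) := (normSeminorm ℂ (lp (fun _ : ℕ+ => ℂ) ∞)).comp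
    ((L : DSpace q.1 →ₗ[ℂ] lp (fun _ : ℕ+ => ℂ) ∞).comp (incl q))
  refine not_isNuclearSpace_of_harmonic (dPlusSubmodule p).subtype p₀
    (L.continuous.comp (continuous_incl q)).norm (fun x n => ?_)
    (fun n => ⟨_, single_mem n (powWeight (-1) n : ℂ)⟩) (fun n => rfl) fun r hr => ?_
  · have h := lp.norm_apply_le_norm ENNReal.top_ne_zero (L (incl q x)) n
    change ‖(powWeight 0 n : ℂ) * x.1 n‖ ≤ _ at h
    rwa [norm_powWeight_mul, powWeight_zero, one_mul] at h
  · let e := equivPowerSeries h1 hp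
    obtain ⟨t, C, hC, h⟩ := PowerSeriesSpace.exists_seminorm_le
      (r.comp (e.symm : PowerSeriesSpace ∞ 0 logSeq →ₗ[ℂ] DPlus p)) (hr.comp e.symm.continuous)
    refine ⟨C, fun x hx => ?_⟩
    have h2 : r x ≤ C * ‖PowerSeriesSpace.weightMap t (e x)‖ := by
      have := h (e x)
      rwa [Seminorm.comp_apply, show (e.symm : PowerSeriesSpace ∞ 0 logSeq →ₗ[ℂ] DPlus p) (e x) = x
        from e.symm_apply_apply x] at this
    refine h2.trans (mul_le_of_le_one_right hC (lp.norm_le_of_forall_le zero_le_one fun n => ?_))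
    rw [PowerSeriesSpace.weightMap_apply, norm_powWeight_mul]
    change _ * ‖(powWeight p.toReal⁻¹ n : ℂ) * x.1 n‖ ≤ 1
    rw [norm_powWeight_mul]
    -- This is where `p ≥ 1` enters: `n^t n^{1/p} n^{-1} ≤ 1` because `t < 0` and `1/p ≤ 1`.
    calc powWeight t.1 n * (powWeight p.toReal⁻¹ n * ‖x.1 n‖)
        ≤ powWeight 0 n * (powWeight 1 n * powWeight (-1) n) := by
          gcongr
          · exact mul_nonneg (powWeight_pos _ _).le (norm_nonneg _)
          · exact (powWeight_pos _ _).le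
          · exact powWeight_mono (le_of_lt t.2) n
          · exact (powWeight_pos _ _).le
          · exact powWeight_mono hP1 n
          · exact hx n
      _ = 1 := by rw [mul_comm (powWeight 1 n), powWeight_neg_mul, powWeight_zero, one_mul]

end DPlus

/-! ### Local convexity of the strong dual -/

open scoped ComplexOrder in
theorem locallyConvexSpace_complex : LocallyConvexSpace ℂ ℂ :=
  .ofBasisZero _ _ _ _ Metric.nhds_basis_ball fun r _ =>
    convex_of_nonneg_surjective_algebraMap _ (fun _ h => RCLike.nonneg_iff_exists_ofReal.1 h)
      (convex_ball (0 : ℂ) r)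

-- Needed because the universal property of the inductive topology concerns locally convex targets
-- only.
open scoped ComplexOrder in
theorem polynormableSpace_strongDual (E : Type*) [AddCommGroup E] [Module ℂ E]
    [TopologicalSpace E] [IsTopologicalAddGroup E] [ContinuousSMul ℂ E] :
    PolynormableSpace ℂ (StrongDual ℂ E) :=
  have := locallyConvexSpace_complex
  have : ContinuousSMul ℝ (StrongDual ℂ E) := IsScalarTower.continuousSMul ℂ
  LocallyConvexSpace.toPolynormableSpace

/-! ### The dual of `Λ¹_0(log n)` -/

/-- The pairing `⟨z, y⟩ = ∑ zₙ yₙ` of `ℓ_∞` and `ℓ_1`. -/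
def lpPairing : lp (fun _ : ℕ+ => ℂ) ∞ →L[ℂ] StrongDual ℂ (lp (fun _ : ℕ+ => ℂ) 1) :=
  have hz : ∀ (z : lp (fun _ : ℕ+ => ℂ) ∞) n, ‖z n‖ ≤ ‖z‖ := fun z n =>
    lp.norm_apply_le_norm ENNReal.top_ne_zero z n
  LinearMap.mkContinuous₂
    (LinearMap.mk₂ ℂ
      (fun z y => lp.tsumCLM ℂ ℕ+ ℂ (lpDiag 1 (fun n => z n) ‖z‖ (norm_nonneg z) (hz z) y))
      (fun z z' y => by
        rw [← map_add]
        exact congrArg _ (lp.ext (funext fun n => add_mul (z n) (z' n) (y n))))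
      (fun c z y => by
        rw [← map_smul]
        exact congrArg _ (lp.ext (funext fun n => mul_assoc c (z n) (y n))))
      (fun z y y' => by rw [map_add, map_add])
      (fun c z y => by rw [map_smul, map_smul])) 1
    fun z y => by
      refine (lp.norm_tsum_le _).trans ?_
      have h := lp.norm_mono (DSpace.q_ne_zero 1) (y := (‖z‖ : ℂ) • y)
        (x := lpDiag 1 (fun n => z n) ‖z‖ (norm_nonneg z) (hz z) y)
        (norm_le_norm_smul_of_forall fun n => by
          rw [lpDiag_apply, norm_mul]
          exact mul_le_mul_of_nonneg_right (hz z n) (norm_nonneg _))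
      rw [one_mul]
      rwa [norm_smul, Complex.norm_of_nonneg (norm_nonneg z)] at h

theorem lpPairing_single (z : lp (fun _ : ℕ+ => ℂ) ∞) (n : ℕ+) (c : ℂ) :
    lpPairing z (lp.single (E := fun _ : ℕ+ => ℂ) 1 n c) = z n * c := by
  change ∑' k, z k * lp.single (E := fun _ : ℕ+ => ℂ) 1 n c k = z n * c
  rw [tsum_eq_single n fun k hk => by rw [lp.single_apply_ne _ _ _ hk, mul_zero],
    lp.single_apply_self]

namespace PowerSeriesSpace

variable {s : ℝ≥0∞} [Fact (1 ≤ s)]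

/-- The unit vectors of the power series space. -/
def unitVec (s : ℝ≥0∞) (n : ℕ+) : PowerSeriesSpace s 0 logSeq :=
  ⟨Pi.single n 1, fun t _ => by
    refine (lp.memℓp (lp.single (E := fun _ : ℕ+ => ℂ) s n
      (Real.exp (t * logSeq n) : ℂ))).mono' fun k => ?_
    by_cases h : k = n
    · subst h
      simp
    · simp [h]⟩

omit [Fact (1 ≤ s)] in
theorem weightMap_smul_unitVec (t : Set.Iio (0 : ℝ)) (n : ℕ+) (c : ℂ) :
    weightMap t (c • unitVec s n)
      = lp.single (E := fun _ : ℕ+ => ℂ) s n ((powWeight t.1 n : ℂ) * c) := by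
  refine lp.ext (funext fun k => ?_)
  rw [weightMap_apply]
  change _ * (c * (Pi.single n 1 : ℕ+ → ℂ) k) = _
  by_cases h : k = n
  · subst h
    simp
  · simp [h]

theorem norm_weightMap_smul_unitVec (t : Set.Iio (0 : ℝ)) (n : ℕ+) (c : ℂ) :
    ‖weightMap t (c • unitVec s n)‖ = powWeight t.1 n * ‖c‖ := by
  rw [weightMap_smul_unitVec, lp.norm_single (zero_lt_one.trans_le Fact.out), norm_powWeight_mul]

theorem exists_norm_le (φ : StrongDual ℂ (PowerSeriesSpace s 0 logSeq)) :
    ∃ (t : Set.Iio (0 : ℝ)) (C : ℝ), 0 ≤ C ∧ ∀ x, ‖φ x‖ ≤ C * ‖weightMap t x‖ :=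
  exists_seminorm_le ((normSeminorm ℂ ℂ).comp (φ : PowerSeriesSpace s 0 logSeq →ₗ[ℂ] ℂ))
    φ.continuous.norm

/-- The unit vectors are total: finite sections converge in `ℓ_s` for finite `s`, and `φ` is bounded
by a single weighted norm. -/
theorem eq_zero_of_unitVec (hs : s ≠ ∞) (φ : StrongDual ℂ (PowerSeriesSpace s 0 logSeq))
    (h : ∀ n, φ (unitVec s n) = 0) : φ = 0 := by
  refine ContinuousLinearMap.ext fun x => norm_le_zero_iff.1 ?_
  obtain ⟨t, C, hC, hφ⟩ := exists_norm_le φ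
  have hsum : HasSum (fun n => weightMap t (x.1 n • unitVec s n)) (weightMap t x) := by
    refine (lp.hasSum_single hs (weightMap t x)).congr_fun ?_
    intro n
    rw [weightMap_smul_unitVec, weightMap_apply]
  have hlim : Filter.Tendsto
      (fun F : Finset ℕ+ => C * ‖weightMap t x - ∑ n ∈ F, weightMap t (x.1 n • unitVec s n)‖)
      Filter.atTop (𝓝 0) := by
    have := ((tendsto_const_nhds (x := weightMap t x)).sub hsum).norm.const_mul C
    simpa using this
  refine ge_of_tendsto' hlim fun F => ?_
  have h1 := hφ (x - ∑ n ∈ F, x.1 n • unitVec s n)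
  rw [map_sub, map_sum, Finset.sum_eq_zero, sub_zero, map_sub, map_sum] at h1
  · exact h1
  · intro n _
    rw [map_smul, h n, smul_zero]

/-- The weight map as a continuous linear map. -/
def weightMapCLM (s : ℝ≥0∞) [Fact (1 ≤ s)] (t : Set.Iio (0 : ℝ)) :
    PowerSeriesSpace s 0 logSeq →L[ℂ] lp (fun _ : ℕ+ => ℂ) s :=
  ⟨weightMap t, continuous_weightMap t⟩

/-- The functional `y ↦ ∑ zₙ n^t yₙ` on `Λ¹_0(log n)`. -/
def pairing (t : Set.Iio (0 : ℝ)) :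
    lp (fun _ : ℕ+ => ℂ) ∞ →L[ℂ] StrongDual ℂ (PowerSeriesSpace 1 0 logSeq) :=
  ((weightMapCLM 1 t).precomp ℂ).comp lpPairing

theorem pairing_unitVec (t : Set.Iio (0 : ℝ)) (z : lp (fun _ : ℕ+ => ℂ) ∞) (n : ℕ+) :
    pairing t z (unitVec 1 n) = (powWeight t.1 n : ℂ) * z n := by
  have h := weightMap_smul_unitVec (s := 1) t n 1
  rw [one_smul, mul_one] at h
  change lpPairing z (weightMap t (unitVec 1 n)) = _
  rw [h, lpPairing_single, mul_comm]

/-- The norm of `aₙ eₙ` with exponent `t` is exactly `n^t |aₙ|`. -/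
theorem isVonNBounded_range_smul_unitVec {a : ℕ+ → ℝ}
    (ha : ∀ t : ℝ, t < 0 → ∃ C : ℝ, ∀ n, powWeight t n * ‖a n‖ ≤ C) :
    Bornology.IsVonNBounded ℂ (Set.range fun n => (a n : ℂ) • unitVec s n) := by
  intro U hU
  obtain ⟨t, ε, hε, h⟩ := exists_weightMap_subset hU
  obtain ⟨C, hC⟩ := ha t.1 t.2
  have hC0 : 0 ≤ C := (mul_nonneg (powWeight_pos _ _).le (norm_nonneg _)).trans (hC 1)
  refine absorbs_iff_norm.2 ⟨C / ε + 1, fun c hc => ?_⟩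
  have hc0 : 0 < ‖c‖ := lt_of_lt_of_le (by positivity) hc
  rintro _ ⟨n, rfl⟩
  refine ⟨c⁻¹ • ((a n : ℂ) • unitVec s n), h _ ?_, smul_inv_smul₀ (norm_pos_iff.1 hc0) _⟩
  rw [map_smul, norm_smul, norm_weightMap_smul_unitVec, norm_inv, Complex.norm_real,
    inv_mul_lt_iff₀ hc0]
  refine (hC n).trans_lt ?_
  have : C / ε < ‖c‖ := lt_of_lt_of_le (lt_add_one _) hc
  rwa [div_lt_iff₀ hε] at this

end PowerSeriesSpace

/-! ### The spaces `d(p-)` -/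

theorem MinusIndex.lt_top {p : ℝ≥0∞} (q : MinusIndex p) : q.1 < ∞ := q.2.2.trans_le le_top

/-- For `p = ∞` the conventions `∞.toReal = 0` and `0⁻¹ = 0` give `1/p` its correct value `0`. -/
theorem MinusIndex.lt_toReal_inv {p : ℝ≥0∞} (q : MinusIndex p) : p.toReal⁻¹ < q.1.toReal⁻¹ := by
  have hq := toReal_pos q.2.1 q.lt_top
  rcases eq_or_ne p ∞ with rfl | hp
  · simpa using hq
  · exact inv_strictAnti₀ hq ((ENNReal.toReal_lt_toReal q.lt_top.ne hp).2 q.2.2)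

theorem toReal_inv_lt_one {p : ℝ≥0∞} (h1 : 1 < p) : p.toReal⁻¹ < 1 := by
  rcases eq_or_ne p ∞ with rfl | hp
  · simp
  · refine inv_lt_one_of_one_lt₀ ?_
    rwa [← ENNReal.toReal_one, ENNReal.toReal_lt_toReal ENNReal.one_ne_top hp]

theorem exists_minusIndex {p : ℝ≥0∞} (h1 : 1 < p) {u : ℝ} (hu : p.toReal⁻¹ < u) :
    ∃ q : MinusIndex p, q.1.toReal⁻¹ < u := by
  -- The exponent is `q = 1 / v`: `v < 1` gives `q > 1`, and `v > 1/p` gives `q < p`.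
  obtain ⟨v, hv1, hv2⟩ := exists_between (lt_min hu (toReal_inv_lt_one h1))
  have hv0 : 0 < v := (inv_nonneg.2 ENNReal.toReal_nonneg).trans_lt hv1
  refine ⟨⟨ENNReal.ofReal v⁻¹, ?_, ?_⟩, ?_⟩
  · rw [ENNReal.one_lt_ofReal]
    exact (one_lt_inv₀ hv0).2 (hv2.trans_le (min_le_right _ _))
  · rcases eq_or_ne p ∞ with rfl | hp
    · exact ENNReal.ofReal_lt_top
    · rw [ENNReal.ofReal_lt_iff_lt_toReal (inv_pos.2 hv0).le hp]
      exact (inv_lt_comm₀ (ENNReal.toReal_pos (zero_lt_one.trans h1).ne' hp) hv0).1 hv1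
  · rw [ENNReal.toReal_ofReal (inv_pos.2 hv0).le, inv_inv]
    exact hv2.trans_le (min_le_left _ _)

/-- The topology pulled back along `T` is one of the competitors in the infimum. -/
theorem continuous_of_inductiveTopology {E F ι : Type*} {G : ι → Type*} [AddCommGroup E]
    [Module ℂ E] [AddCommGroup F] [Module ℂ F] [∀ i, TopologicalSpace (G i)]
    [TopologicalSpace F] [PolynormableSpace ℂ F] (f : ∀ i, G i → E) (T : E →ₗ[ℂ] F)
    (h : ∀ i, Continuous (T ∘ f i)) : Continuous[inductiveTopology f, inferInstance] T :=
  continuous_iff_le_induced.2 <| sInf_le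
    ⟨PolynormableSpace.induced T, fun i => continuous_induced_rng.2 (h i)⟩

namespace DMinus

variable {p : ℝ≥0∞}

theorem continuous_incl (q : MinusIndex p) : Continuous (incl q) :=
  continuous_sInf_rng.2 fun _ ht => ht.2 q

theorem continuous_of_comp_incl {F : Type*} [AddCommGroup F] [Module ℂ F] [TopologicalSpace F]
    [PolynormableSpace ℂ F] (T : DMinus p →ₗ[ℂ] F) (h : ∀ q, Continuous (T ∘ incl q)) :
    Continuous T :=
  continuous_of_inductiveTopology (fun q : MinusIndex p => incl q) T h

/-- With `mem_of_norm_le`, this describes `d(p-)` as the sequences of size `O(n^{-u})` for some `u >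
1/p`. -/
theorem exists_norm_le (hp : 1 < p) (x : DMinus p) :
    ∃ u : ℝ, p.toReal⁻¹ < u ∧ ∃ c : ℝ, 0 ≤ c ∧ ∀ n, ‖x.1 n‖ ≤ c * powWeight (-u) n := by
  obtain ⟨q, hq1, hqp, hx⟩ := (mem_dMinusSubmodule hp).1 x.2
  let q' : MinusIndex p := ⟨q, hq1, hqp⟩
  have : Fact (1 ≤ q) := ⟨hq1.le⟩
  let y : DSpace q := ⟨x.1, hx⟩
  refine ⟨q.toReal⁻¹, q'.lt_toReal_inv, ‖y‖, norm_nonneg y, fun n => ?_⟩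
  have h := DSpace.powWeight_mul_norm_le hq1 q'.lt_top le_rfl y n
  calc ‖x.1 n‖ = powWeight q.toReal⁻¹ n * ‖x.1 n‖ * powWeight (-q.toReal⁻¹) n := by
        rw [mul_right_comm, mul_comm (powWeight _ n), powWeight_neg_mul, one_mul]
    _ ≤ _ := mul_le_mul_of_nonneg_right h (powWeight_pos _ _).le

theorem mem_of_norm_le (hp : 1 < p) {u : ℝ} (hu : p.toReal⁻¹ < u) {x : ℕ+ → ℂ} {c : ℝ}
    (hc : 0 ≤ c) (hx : ∀ n, ‖x n‖ ≤ c * powWeight (-u) n) : x ∈ dMinusSubmodule p := by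
  obtain ⟨q, hq⟩ := exists_minusIndex hp hu
  exact (mem_dMinusSubmodule hp).2 ⟨q.1, q.2.1, q.2.2, mem_dSubmodule_of_le q.2.1 q.lt_top hq hc hx⟩

/-- Such sequences lie in a single `d(q)`, where `r` is bounded by the norm. The normalization `1 ≤
M` keeps the infimum in `exists_weight` at least `1`. -/
theorem exists_seminorm_le (hp : 1 < p) (r : Seminorm ℂ (DMinus p)) (hr : Continuous r) {u : ℝ}
    (hu : p.toReal⁻¹ < u) : ∃ M : ℝ, 1 ≤ M ∧ ∀ (x : DMinus p) (c : ℝ), 0 ≤ c →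
      (∀ n, ‖x.1 n‖ ≤ c * powWeight (-u) n) → r x ≤ M * c := by
  obtain ⟨q, hq⟩ := exists_minusIndex hp hu
  obtain ⟨K, hK, h⟩ := DSpace.exists_norm_le q.2.1 q.lt_top hq
  obtain ⟨C, hC, hrC⟩ := Seminorm.bound_of_continuous_normedSpace (r.comp (incl q))
    (hr.comp (continuous_incl q))
  refine ⟨max 1 (C * K), le_max_left _ _, fun x c hc hx => ?_⟩
  let y : DSpace q.1 := ⟨x.1, mem_dSubmodule_of_le q.2.1 q.lt_top hq hc hx⟩
  calc r x = r.comp (incl q) y := rfl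
    _ ≤ C * (K * c) := (hrC y).trans (mul_le_mul_of_nonneg_left (h y c hc hx) hC.le)
    _ ≤ max 1 (C * K) * c := by
      rw [← mul_assoc]
      exact mul_le_mul_of_nonneg_right (le_max_right _ _) hc

/-- Coordinatewise restriction of a sequence in `d(p-)` to a set of indices. -/
def restrict (hp : 1 < p) (A : Set ℕ+) (x : DMinus p) : DMinus p :=
  ⟨A.indicator x.1, by
    obtain ⟨u, hu, c, hc, h⟩ := exists_norm_le hp x
    exact mem_of_norm_le hp hu hc fun n => (norm_indicator_le_norm_self _ n).trans (h n)⟩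

theorem restrict_apply (hp : 1 < p) (A : Set ℕ+) (x : DMinus p) :
    (restrict hp A x).1 = A.indicator x.1 := rfl

theorem eq_sum_restrict (hp : 1 < p) (κ : ℕ+ → ℕ) (K : ℕ) (x : DMinus p) :
    x = ∑ k ∈ Finset.range K, restrict hp {n | κ n = k} x + restrict hp {n | K ≤ κ n} x := by
  refine Subtype.ext ?_
  let v : DMinus p →ₗ[ℂ] ℕ+ → ℂ := (dMinusSubmodule p).subtype
  change v x = v (∑ k ∈ Finset.range K, restrict hp {n | κ n = k} x + restrict hp {n | K ≤ κ n} x)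
  rw [map_add, map_sum]
  funext n
  rw [Pi.add_apply, Finset.sum_apply]
  change x.1 n = ∑ k ∈ Finset.range K, Set.indicator {n | κ n = k} x.1 n
    + Set.indicator {n | K ≤ κ n} x.1 n
  simp only [Set.indicator_apply, Set.mem_ofPred_eq, Finset.sum_ite_eq, Finset.mem_range]
  by_cases h : κ n < K
  · simp [h, h.not_ge]
  · simp [h, not_lt.1 h]

/-- Choose `1/p < v < u` with `x = O(n^{-u})`: against `n^{-v}` there is a spare factor `n^{v-u} →
0`, so tails of `x` are small for `r`. Taking `K` above all `κ n` with `n < N` forces `κ n ≥ K` into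
the tail. -/
theorem seminorm_restrict_small (hp : 1 < p) (r : Seminorm ℂ (DMinus p)) (hr : Continuous r)
    (κ : ℕ+ → ℕ) (x : DMinus p) : ∃ K : ℕ, r (restrict hp {n | K ≤ κ n} x) ≤ 1 := by
  obtain ⟨u, hu, c, hc, hx⟩ := exists_norm_le hp x
  obtain ⟨v, hv1, hv2⟩ := exists_between hu
  obtain ⟨M, hM, hrM⟩ := exists_seminorm_le hp r hr hv1
  have hη : 0 < 1 / (M * (c + 1)) := by positivity
  obtain ⟨N, hN⟩ := ((tendsto_powWeight (sub_neg.2 hv2)).eventually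
    (gt_mem_nhds hη)).exists_forall_of_atTop
  obtain ⟨K, hK⟩ := ((Finset.range N).image fun i => κ i.toPNat').bddAbove
  refine ⟨K + 1, ?_⟩
  have hle : ∀ n, K + 1 ≤ κ n → powWeight (v - u) n ≤ 1 / (M * (c + 1)) := fun n hn => by
    refine (hN n ?_).le
    by_contra hlt
    have h1 : κ n ≤ K := hK (Finset.mem_coe.2 (Finset.mem_image.2
      ⟨n, Finset.mem_range.2 (not_le.1 hlt), by simp⟩))
    omega
  refine (hrM _ (c * (1 / (M * (c + 1)))) (by positivity) fun n => ?_).trans ?_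
  · rw [restrict_apply]
    by_cases hn : K + 1 ≤ κ n
    · rw [Set.indicator_of_mem (by exact hn)]
      refine (hx n).trans ?_
      rw [show -u = (v - u) + -v by ring, powWeight_add, ← mul_assoc]
      exact mul_le_mul_of_nonneg_right (mul_le_mul_of_nonneg_left (hle n hn) hc)
        (powWeight_pos _ _).le
    · rw [Set.indicator_of_notMem (by exact hn), norm_zero]
      exact mul_nonneg (by positivity) (powWeight_pos _ _).le
  · have : M ≠ 0 := by positivity
    field_simp
    linarith

/-- Each continuous seminorm on `d(p-)` is dominated by a weighted sup norm. -/
theorem exists_weight (hp : 1 < p) (r : Seminorm ℂ (DMinus p)) (hr : Continuous r) :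
    ∃ a : ℕ+ → ℝ, (∀ n, 0 < a n) ∧
      (∀ t : ℝ, t < 0 → ∃ C : ℝ, ∀ n, powWeight t n * ‖a n‖ ≤ C) ∧
      ∀ x : DMinus p, (∀ n, a n * (powWeight p.toReal⁻¹ n * ‖x.1 n‖) ≤ 1) → r x ≤ 5 := by
  have hpos : ∀ k : ℕ, (0 : ℝ) < 1 / ((k : ℝ) + 1) := fun k => by positivity
  choose M hM1 hM using fun k : ℕ => exists_seminorm_le hp r hr
    (lt_add_of_pos_right p.toReal⁻¹ (hpos k))
  -- The weight is `aₙ = inf_k f n k`. The factor `n^{1/(k+1)}` makes it grow more slowly than each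
  -- positive power, `M k` compensates `r` on the `k`-th step, and `2^k` makes the pieces summable.
  let f : ℕ+ → ℕ → ℝ := fun n k => 2 ^ k * M k * powWeight (1 / ((k : ℝ) + 1)) n
  have hf1 : ∀ n k, 1 ≤ f n k := fun n k => by
    have h2 : 1 ≤ powWeight (1 / ((k : ℝ) + 1)) n :=
      (powWeight_zero n).symm.trans_le (powWeight_mono (hpos k).le n)
    exact one_le_mul_of_one_le_of_one_le
      (one_le_mul_of_one_le_of_one_le (one_le_pow₀ one_le_two) (hM1 k)) h2
  have hbdd : ∀ n, BddBelow (Set.range (f n)) := fun n => ⟨1, by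
    rintro _ ⟨k, rfl⟩
    exact hf1 n k⟩
  have ha1 : ∀ n, 1 ≤ ⨅ k, f n k := fun n => le_ciInf (hf1 n)
  have hκ : ∀ n, ∃ k, f n k < 2 * ⨅ k, f n k := fun n =>
    exists_lt_of_ciInf_lt (by linarith [ha1 n])
  -- The indices are split into blocks according to the `k` that attains the infimum up to a factor
  -- `2`.
  choose κ hκ using hκ
  refine ⟨fun n => ⨅ k, f n k, fun n => zero_lt_one.trans_le (ha1 n), fun t ht => ?_,
    fun x hx => ?_⟩
  · obtain ⟨k, hk⟩ := exists_nat_one_div_lt (K := ℝ) (neg_pos.2 ht)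
    have hk0 : 0 ≤ 2 ^ k * M k := by have := hM1 k; positivity
    refine ⟨2 ^ k * M k, fun n => ?_⟩
    rw [Real.norm_of_nonneg (zero_le_one.trans (ha1 n))]
    calc powWeight t n * ⨅ k, f n k ≤ powWeight t n * f n k :=
          mul_le_mul_of_nonneg_left (ciInf_le (hbdd n) k) (powWeight_pos _ _).le
      _ = 2 ^ k * M k * powWeight (t + 1 / ((k : ℝ) + 1)) n := by
          rw [powWeight_add]
          ring
      _ ≤ 2 ^ k * M k := mul_le_of_le_one_right hk0
          ((powWeight_mono (by linarith) n).trans_eq (powWeight_zero n))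
  -- The blocks below `K` contribute at most `∑ 2 * 2^{-k} ≤ 4` and the remaining tail at most `1`.
  -- Only `K` depends on `x`, and the bound `5` does not see it.
  · obtain ⟨K, hK⟩ := seminorm_restrict_small hp r hr κ x
    have hpiece : ∀ k, r (restrict hp {n | κ n = k} x) ≤ 2 * (1 / 2) ^ k := fun k => by
      have hMk : 0 < M k := zero_lt_one.trans_le (hM1 k)
      refine (hM k _ (2 * (1 / 2) ^ k / M k) (by positivity) fun n => ?_).trans_eq
        (mul_div_cancel₀ _ hMk.ne')
      rw [restrict_apply]
      by_cases hn : κ n = k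
      · rw [Set.indicator_of_mem (by exact hn)]
        have h1 := hx n
        have h2 := hκ n
        rw [hn] at h2
        have h3 : f n k * (powWeight p.toReal⁻¹ n * ‖x.1 n‖) ≤ 2 := by
          have h0 : 0 ≤ powWeight p.toReal⁻¹ n * ‖x.1 n‖ :=
            mul_nonneg (powWeight_pos _ _).le (norm_nonneg _)
          nlinarith [mul_le_mul_of_nonneg_right h2.le h0]
        have h4 : powWeight (p.toReal⁻¹ + 1 / ((k : ℝ) + 1)) n * ‖x.1 n‖
            ≤ 2 * (1 / 2) ^ k / M k := by
          rw [le_div_iff₀ hMk, one_div_pow, mul_one_div, le_div_iff₀ (by positivity),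
            powWeight_add]
          refine le_trans (le_of_eq ?_) h3
          simp only [f]
          ring
        calc ‖x.1 n‖ = powWeight (p.toReal⁻¹ + 1 / ((k : ℝ) + 1)) n * ‖x.1 n‖ *
              powWeight (-(p.toReal⁻¹ + 1 / ((k : ℝ) + 1))) n := by
              rw [mul_right_comm, mul_comm (powWeight _ n), powWeight_neg_mul, one_mul]
          _ ≤ _ := mul_le_mul_of_nonneg_right h4 (powWeight_pos _ _).le
      · rw [Set.indicator_of_notMem (by exact hn), norm_zero]
        exact mul_nonneg (by positivity) (powWeight_pos _ _).le
    have hsum : ∑ k ∈ Finset.range K, r (restrict hp {n | κ n = k} x) ≤ 4 := by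
      refine (Finset.sum_le_sum fun k _ => hpiece k).trans ?_
      rw [← Finset.mul_sum]
      have := summable_geometric_two.sum_le_tsum (Finset.range K) fun k _ => by positivity
      rw [tsum_geometric_two] at this
      linarith
    have hle : r (∑ k ∈ Finset.range K, restrict hp {n | κ n = k} x)
        ≤ ∑ k ∈ Finset.range K, r (restrict hp {n | κ n = k} x) :=
      Finset.le_sum_of_subadditive r (map_zero r).le (map_add_le_add r) _ _
    rw [eq_sum_restrict hp κ K x]
    exact (map_add_le_add r _ _).trans (by linarith)

/-! ### The isomorphism of `d(p-)` with the strong dual -/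

theorem powWeight_mul_unitVec_mem (hp : 1 < p)
    (φ : StrongDual ℂ (PowerSeriesSpace 1 0 logSeq)) :
    (fun n => (powWeight (-p.toReal⁻¹) n : ℂ) * φ (PowerSeriesSpace.unitVec 1 n))
      ∈ dMinusSubmodule p := by
  obtain ⟨t, C, hC, h⟩ := PowerSeriesSpace.exists_norm_le φ
  -- Continuity gives `|φ(eₙ)| ≤ C n^t` with `t < 0`, so the decay exponent `1/p - t` exceeds `1/p`.
  refine mem_of_norm_le hp (u := p.toReal⁻¹ - t.1) (by linarith [show t.1 < 0 from t.2]) hC fun n => ?_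
  have h1 := h (PowerSeriesSpace.unitVec 1 n)
  have h2 := PowerSeriesSpace.norm_weightMap_smul_unitVec (s := 1) t n 1
  rw [one_smul, norm_one, mul_one] at h2
  rw [h2] at h1
  rw [norm_powWeight_mul, show -(p.toReal⁻¹ - t.1) = -p.toReal⁻¹ + t.1 by ring, powWeight_add,
    mul_left_comm]
  exact mul_le_mul_of_nonneg_left h1 (powWeight_pos _ _).le

/-- The map `φ ↦ (n^{-1/p} φ(eₙ))ₙ` from the dual of `Λ¹_0(log n)` to `d(p-)`. -/
def ofDual (hp : 1 < p) : StrongDual ℂ (PowerSeriesSpace 1 0 logSeq) →ₗ[ℂ] DMinus p where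
  toFun φ := ⟨_, powWeight_mul_unitVec_mem hp φ⟩
  map_add' φ ψ := Subtype.ext (funext fun n =>
    mul_add _ (φ (PowerSeriesSpace.unitVec 1 n)) (ψ (PowerSeriesSpace.unitVec 1 n)))
  map_smul' c φ := Subtype.ext (funext fun n =>
    mul_left_comm _ c (φ (PowerSeriesSpace.unitVec 1 n)))

theorem ofDual_apply (hp : 1 < p) (φ : StrongDual ℂ (PowerSeriesSpace 1 0 logSeq)) (n : ℕ+) :
    (ofDual hp φ).1 n = (powWeight (-p.toReal⁻¹) n : ℂ) * φ (PowerSeriesSpace.unitVec 1 n) := rfl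

theorem ofDual_injective (hp : 1 < p) : Function.Injective (ofDual hp) := by
  refine (injective_iff_map_eq_zero _).2 fun φ h => ?_
  refine PowerSeriesSpace.eq_zero_of_unitVec ENNReal.one_ne_top φ fun n => ?_
  have h1 : (ofDual hp φ).1 n = 0 := by rw [h]; rfl
  rw [ofDual_apply] at h1
  exact (mul_eq_zero.1 h1).resolve_left (Complex.ofReal_ne_zero.2 (powWeight_pos _ n).ne')

/-- The functional on `Λ¹_0(log n)` defined by a sequence in `d(q)`, `q < p`. -/
def dualOfDSpace (q : MinusIndex p) :
    DSpace q.1 →L[ℂ] StrongDual ℂ (PowerSeriesSpace 1 0 logSeq) :=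
  (PowerSeriesSpace.pairing ⟨p.toReal⁻¹ - q.1.toReal⁻¹, sub_neg.2 q.lt_toReal_inv⟩).comp
    (DSpace.toLinf q.2.1 q.lt_top le_rfl)

/-- The three weights cancel: `n^{-1/p} n^{1/p-1/q} n^{1/q} = 1`. -/
theorem ofDual_dualOfDSpace (hp : 1 < p) (q : MinusIndex p) (x : DSpace q.1) :
    ofDual hp (dualOfDSpace q x) = incl q x := by
  refine Subtype.ext (funext fun n => ?_)
  rw [ofDual_apply, dualOfDSpace, ContinuousLinearMap.comp_apply,
    PowerSeriesSpace.pairing_unitVec]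
  change (powWeight (-p.toReal⁻¹) n : ℂ) * ((powWeight (p.toReal⁻¹ - q.1.toReal⁻¹) n : ℂ) *
    ((powWeight q.1.toReal⁻¹ n : ℂ) * x.1 n)) = x.1 n
  rw [← mul_assoc (powWeight (p.toReal⁻¹ - q.1.toReal⁻¹) n : ℂ), ← Complex.ofReal_mul,
    ← powWeight_add, sub_add_cancel, powWeight_neg_mul_mul]

theorem ofDual_surjective (hp : 1 < p) : Function.Surjective (ofDual hp) := fun x => by
  obtain ⟨q, hq1, hqp, hx⟩ := (mem_dMinusSubmodule hp).1 x.2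
  exact ⟨_, ofDual_dualOfDSpace hp ⟨q, hq1, hqp⟩ ⟨x.1, hx⟩⟩

/-- The functionals mapping the bounded set `{aₙ eₙ}` into the unit disc form a neighbourhood of
zero in the strong dual. For the image `x` of such a `φ`, `aₙ n^{1/p} |xₙ| = |φ(aₙ eₙ)| ≤ 1`, hence
`r x ≤ 5`. -/
theorem continuous_ofDual (hp : 1 < p) : Continuous (ofDual hp) := by
  refine (PolynormableSpace.withSeminorms ℂ (DMinus p)).continuous_of_continuous_comp _ fun r => ?_
  obtain ⟨a, ha0, ha, hr⟩ := exists_weight hp r.1 r.2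
  refine Seminorm.continuous' (r := 5) ?_
  filter_upwards [ContinuousLinearMap.eventually_nhds_zero_mapsTo
    (PowerSeriesSpace.isVonNBounded_range_smul_unitVec (s := 1) ha)
    (Metric.closedBall_mem_nhds (0 : ℂ) one_pos)] with φ hφ
  rw [Seminorm.mem_closedBall_zero]
  refine hr _ fun n => ?_
  have h := mem_closedBall_zero_iff.1 (hφ ⟨n, rfl⟩)
  rw [map_smul, norm_smul, Complex.norm_of_nonneg (ha0 n).le] at h
  rwa [ofDual_apply, ← norm_powWeight_mul, powWeight_mul_neg_mul]

/-- `d(p-)` is isomorphic to the strong dual of `Λ¹_0(log n)`. -/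
def equivDual (hp : 1 < p) : DMinus p ≃L[ℂ] StrongDual ℂ (PowerSeriesSpace 1 0 logSeq) :=
  let e := LinearEquiv.ofBijective (ofDual hp) ⟨ofDual_injective hp, ofDual_surjective hp⟩
  { toLinearEquiv := e.symm
    continuous_toFun := by
      have := polynormableSpace_strongDual (PowerSeriesSpace 1 0 logSeq)
      refine continuous_of_comp_incl (e.symm : DMinus p →ₗ[ℂ] _) fun q =>
        (dualOfDSpace q).continuous.congr fun x => ?_
      exact (e.symm_apply_eq.2 (ofDual_dualOfDSpace hp q x).symm).symm
    continuous_invFun := continuous_ofDual hp }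

theorem isDFSSpace (hp : 1 < p) : IsDFSSpace (DMinus p) :=
  ⟨PowerSeriesSpace 1 0 logSeq, inferInstance, inferInstance, inferInstance, inferInstance,
    PowerSeriesSpace.isFrechetSchwartzSpace, ⟨equivDual hp⟩⟩

/-! ### Non-nuclearity of `d(p-)` -/

theorem single_mem (hp : 1 < p) (n : ℕ+) (c : ℂ) :
    (Pi.single n c : ℕ+ → ℂ) ∈ dMinusSubmodule p := by
  refine mem_of_norm_le hp (lt_add_one _) (c := ‖c‖ / powWeight (-(p.toReal⁻¹ + 1)) n)
    (div_nonneg (norm_nonneg _) (powWeight_pos _ _).le) fun k => ?_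
  by_cases h : k = n
  · subst h
    rw [Pi.single_eq_same, div_mul_cancel₀ _ (powWeight_pos _ _).ne']
  · rw [Pi.single_eq_of_ne h, norm_zero]
    exact mul_nonneg (div_nonneg (norm_nonneg _) (powWeight_pos _ _).le) (powWeight_pos _ _).le

/-- The inclusion of `d(p-)` into `ℓ_∞`. -/
def toLinf (hp : 1 < p) : DMinus p →ₗ[ℂ] lp (fun _ : ℕ+ => ℂ) ∞ where
  toFun x := ⟨x.1, by
    obtain ⟨q, _, _, hx⟩ := (mem_dMinusSubmodule hp).1 x.2
    exact hx.1⟩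
  map_add' _ _ := rfl
  map_smul' _ _ := rfl

theorem continuous_toLinf (hp : 1 < p) : Continuous (toLinf hp) := by
  refine continuous_of_comp_incl _ fun q => ?_
  refine (DSpace.toLinf q.2.1 q.lt_top (s := 0)
    (inv_nonneg.2 ENNReal.toReal_nonneg)).continuous.congr fun x => lp.ext (funext fun n => ?_)
  change (powWeight 0 n : ℂ) * x.1 n = x.1 n
  rw [powWeight_zero, Complex.ofReal_one, one_mul]

theorem not_isNuclearSpace (hp : 1 < p) : ¬ IsNuclearSpace (DMinus p) := by
  refine not_isNuclearSpace_of_harmonic (dMinusSubmodule p).subtype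
    ((normSeminorm ℂ (lp (fun _ : ℕ+ => ℂ) ∞)).comp (toLinf hp)) (continuous_toLinf hp).norm
    (fun x n => lp.norm_apply_le_norm ENNReal.top_ne_zero (toLinf hp x) n)
    (fun n => ⟨_, single_mem hp n (powWeight (-1) n : ℂ)⟩) (fun n => rfl) fun r hr => ?_
  -- As `1/p < 1`, the exponent `u = 1` is admissible, so `r` is bounded on the sequences dominated
  -- by `1/n`.
  obtain ⟨M, _, hM⟩ := exists_seminorm_le hp r hr (toReal_inv_lt_one hp)
  exact ⟨M * 1, fun x hx => hM x 1 zero_le_one fun n => (hx n).trans_eq (one_mul _).symm⟩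

end DMinus

end CesaroDual

end

theorem corollary4p5 :
    (∀ p : ℝ≥0∞, 1 < p →
      ¬ IsNuclearSpace (DMinus p) ∧
      IsDFSSpace (DMinus p) ∧
      Nonempty (DMinus p ≃L[ℂ] StrongDual ℂ (PowerSeriesSpace 1 0 logSeq))) ∧
    (∀ p : ℝ≥0∞, 1 ≤ p → p < ∞ →
      ¬ IsNuclearSpace (DPlus p) ∧
      IsFrechetSchwartzSpace (DPlus p) ∧
      Nonempty (DPlus p ≃L[ℂ] PowerSeriesSpace ∞ 0 logSeq)) :=
  ⟨fun _ hp => ⟨DMinus.not_isNuclearSpace hp, DMinus.isDFSSpace hp, ⟨DMinus.equivDual hp⟩⟩,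
    fun _ h1 hp => ⟨DPlus.not_isNuclearSpace h1 hp, DPlus.isFrechetSchwartzSpace h1 hp,
      ⟨DPlus.equivPowerSeries h1 hp⟩⟩⟩
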